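/- Let $k$ be an algebraically closed field of characteristic zero and let $n\ge 3$ be an even integer. For $1\le i\le n$ let $t_i=(2i-1,\,2i)\in\mathbb S_{2n}$, let $H=\langle t_1,\dots,t_n\rangle\cong(\mathbb Z_2)^n$, and let $\widehat H=\operatorname{Hom}(H,k^*)$, which is generated by the characters $a_1,\dots,a_n$ with $a_i(t_i)=-1$ and $a_i(t_j)=1$ for $j\ne i$. Let $\omega:\widehat H\times\widehat H\to k^*$ be the bicharacter with $\omega(a_i,a_j)=-1$ for $i<j$ and $\omega(a_i,a_j)=1$ for $i\ge j$. Put $$J=\sum_{\alpha,\beta\in\widehat H}\omega(\alpha,\beta)\,e_\alpha\otimes e_\beta\in kH\otimes kH\subseteq k\mathbb S_{2n}\otimes k\mathbb S_{2n},\qquad e_\chi=\frac1{|H|}\sum_{h\in H}\chi(h^{-1})\,h .$$ Then $J$ is a twist of the Hopf algebra $k\mathbb S_{2n}$, that is, $J$ is invertible, $(\Delta\otimes\mathrm{id})(J)(J\otimes1)=(\mathrm{id}\otimes\Delta)(J)(1\otimes J)$ and $(\varepsilon\otimes\mathrm{id})(J)=(\mathrm{id}\otimes\varepsilon)(J)=1$.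 Let $(k\mathbb S_{2n})^J$ be the twisted Hopf algebra: the algebra $k\mathbb S_{2n}$ with the same counit, comultiplication $\Delta^J(h)=J^{-1}\Delta(h)J$ and antipode $S^J(h)=v^{-1}S(h)v$, where $v=m(S\otimes\mathrm{id})(J)$. Theorem. The Hopf algebra $(k\mathbb S_{2n})^J$ is simple: it is not $k$, and it has no Hopf subalgebra $K$, other than $k1$ and itself, that is normal, i.e. stable under the left adjoint action ${}^hx=\sum h_1\,x\,S^J(h_2)$, where $\sum h_1\otimes h_2=\Delta^J(h)$. -/

import Mathlib

open scoped TensorProduct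

/-! ### Twisting deformations of a Hopf algebra -/

/-- A twist of a Hopf algebra `A`: an invertible `J ∈ A ⊗ A` with
`(Δ ⊗ id)(J) (J ⊗ 1) = (id ⊗ Δ)(J) (1 ⊗ J)` and `(ε ⊗ id)(J) = 1 = (id ⊗ ε)(J)`. -/
structure HopfTwist (k A : Type*) [Field k] [Ring A] [HopfAlgebra k A] where
  /-- The underlying invertible element of `A ⊗ A`. -/
  J : (A ⊗[k] A)ˣ
  cocycle :
    Algebra.TensorProduct.assoc k k k A A A
        (Algebra.TensorProduct.map (Bialgebra.comulAlgHom k A) (AlgHom.id k A) (J : A ⊗[k] A) *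
          ((J : A ⊗[k] A) ⊗ₜ[k] (1 : A))) =
      Algebra.TensorProduct.map (AlgHom.id k A) (Bialgebra.comulAlgHom k A) (J : A ⊗[k] A) *
          ((1 : A) ⊗ₜ[k] (J : A ⊗[k] A))
  counit_left :
    Algebra.TensorProduct.lid k A
      (Algebra.TensorProduct.map (Bialgebra.counitAlgHom k A) (AlgHom.id k A)
        (J : A ⊗[k] A)) = 1
  counit_right :
    Algebra.TensorProduct.rid k k A
      (Algebra.TensorProduct.map (AlgHom.id k A) (Bialgebra.counitAlgHom k A)
        (J : A ⊗[k] A)) = 1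

namespace HopfTwist

section Construction

variable {k A : Type*} [Field k] [Ring A] [HopfAlgebra k A]

/-- The linear map `a ⊗ b ↦ S(a) c b`. -/
noncomputable def sandwichLeft (k : Type*) {A : Type*} [Field k] [Ring A] [HopfAlgebra k A]
    (c : A) : A ⊗[k] A →ₗ[k] A :=
  LinearMap.mul' k A ∘ₗ
    TensorProduct.map (LinearMap.mulRight k c ∘ₗ HopfAlgebra.antipode k) LinearMap.id

/-- The linear map `a ⊗ b ↦ a c S(b)`. -/
noncomputable def sandwichRight (k : Type*) {A : Type*} [Field k] [Ring A] [HopfAlgebra k A]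
    (c : A) : A ⊗[k] A →ₗ[k] A :=
  LinearMap.mul' k A ∘ₗ
    TensorProduct.map (LinearMap.mulRight k c) (HopfAlgebra.antipode k)

theorem sandwichLeft_tmul (c a b : A) :
    sandwichLeft k c (a ⊗ₜ[k] b) = HopfAlgebra.antipode k a * c * b := by
  simp [sandwichLeft]

theorem sandwichRight_tmul (c a b : A) :
    sandwichRight k c (a ⊗ₜ[k] b) = a * c * HopfAlgebra.antipode k b := by
  simp [sandwichRight]

theorem sandwichLeft_smul (r : k) (c : A) (X : A ⊗[k] A) :
    sandwichLeft k (r • c) X = r • sandwichLeft k c X := by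
  induction X with
  | zero => simp
  | tmul a b => simp [sandwichLeft_tmul]
  | add X Y hX hY => simp [hX, hY]

theorem sandwichRight_smul (r : k) (c : A) (X : A ⊗[k] A) :
    sandwichRight k (r • c) X = r • sandwichRight k c X := by
  induction X with
  | zero => simp
  | tmul a b => simp [sandwichRight_tmul]
  | add X Y hX hY => simp [hX, hY]

theorem sandwichLeft_add (c d : A) (X : A ⊗[k] A) :
    sandwichLeft k (c + d) X = sandwichLeft k c X + sandwichLeft k d X := by
  induction X with
  | zero => simp
  | tmul a b => simp [sandwichLeft_tmul, mul_add, add_mul]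
  | add X Y hX hY => rw [map_add, map_add, map_add, hX, hY]; abel

theorem sandwichRight_add (c d : A) (X : A ⊗[k] A) :
    sandwichRight k (c + d) X = sandwichRight k c X + sandwichRight k d X := by
  induction X with
  | zero => simp
  | tmul a b => simp [sandwichRight_tmul, mul_add, add_mul]
  | add X Y hX hY => rw [map_add, map_add, map_add, hX, hY]; abel

theorem sandwichLeft_zero (X : A ⊗[k] A) : sandwichLeft k (0 : A) X = 0 := by
  simpa using sandwichLeft_smul (0 : k) (0 : A) X

theorem sandwichRight_zero (X : A ⊗[k] A) : sandwichRight k (0 : A) X = 0 := by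
  simpa using sandwichRight_smul (0 : k) (0 : A) X

theorem sandwichLeft_mul (c : A) (X Y : A ⊗[k] A) :
    sandwichLeft k c (X * Y) = sandwichLeft k (sandwichLeft k c X) Y := by
  induction Y with
  | zero => simp
  | add Y Z hY hZ => simp [mul_add, hY, hZ]
  | tmul a b =>
    induction X with
    | zero => simp [sandwichLeft_zero]
    | add X Z hX hZ => simp [add_mul, hX, hZ, sandwichLeft_add]
    | tmul x y => simp [sandwichLeft_tmul, HopfAlgebra.antipode_mul_antidistrib, mul_assoc]

theorem sandwichRight_mul (c : A) (X Y : A ⊗[k] A) :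
    sandwichRight k c (X * Y) = sandwichRight k (sandwichRight k c Y) X := by
  induction Y with
  | zero => simp [sandwichRight_zero]
  | add Y Z hY hZ => simp [mul_add, hY, hZ, sandwichRight_add]
  | tmul a b =>
    induction X with
    | zero => simp
    | add X Z hX hZ => simp [add_mul, hX, hZ]
    | tmul x y => simp [sandwichRight_tmul, HopfAlgebra.antipode_mul_antidistrib, mul_assoc]

theorem sandwichLeft_comul (h : A) :
    sandwichLeft k (1 : A) (Coalgebra.comul h) = Coalgebra.counit (R := k) h • (1 : A) := by
  have := HopfAlgebra.mul_antipode_rTensor_comul_apply (R := k) h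
  rw [Algebra.algebraMap_eq_smul_one] at this
  rw [← this, sandwichLeft, LinearMap.comp_apply, LinearMap.rTensor]
  simp

theorem sandwichRight_comul (h : A) :
    sandwichRight k (1 : A) (Coalgebra.comul h) = Coalgebra.counit (R := k) h • (1 : A) := by
  have := HopfAlgebra.mul_antipode_lTensor_comul_apply (R := k) h
  rw [Algebra.algebraMap_eq_smul_one] at this
  rw [← this, sandwichRight, LinearMap.comp_apply, LinearMap.lTensor]
  simp

theorem sandwichLeft_one (c : A) : sandwichLeft k c (1 : A ⊗[k] A) = c := by
  simp [Algebra.TensorProduct.one_def, sandwichLeft_tmul]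

theorem sandwichRight_one (c : A) : sandwichRight k c (1 : A ⊗[k] A) = c := by
  simp [Algebra.TensorProduct.one_def, sandwichRight_tmul]

variable (T : HopfTwist k A)

/-- `Δ^J(h) = J⁻¹ Δ(h) J`, as an algebra map. -/
noncomputable def comulTwist : A →ₐ[k] A ⊗[k] A :=
  AlgHom.ofLinearMap
    (LinearMap.mulLeft k (↑T.J⁻¹ : A ⊗[k] A) ∘ₗ LinearMap.mulRight k (T.J : A ⊗[k] A) ∘ₗ
      Coalgebra.comul)
    (by simp)
    (fun x y => by
      simp only [LinearMap.comp_apply, LinearMap.mulLeft_apply, LinearMap.mulRight_apply,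
        Bialgebra.comul_mul]
      simp only [mul_assoc]
      rw [← mul_assoc (T.J : A ⊗[k] A) (↑T.J⁻¹ : A ⊗[k] A), T.J.mul_inv, one_mul])

theorem comulTwist_apply (h : A) :
    T.comulTwist h = (↑T.J⁻¹ : A ⊗[k] A) * (Coalgebra.comul h * (T.J : A ⊗[k] A)) := rfl

/-- `v = m (S ⊗ id)(J)`. -/
noncomputable def v : A :=
  LinearMap.mul' k A ((HopfAlgebra.antipode k).rTensor A (T.J : A ⊗[k] A))

/-- `m (id ⊗ S)(J⁻¹)`, the inverse of `v`. -/
noncomputable def vInv : A :=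
  LinearMap.mul' k A ((HopfAlgebra.antipode k).lTensor A (↑T.J⁻¹ : A ⊗[k] A))

theorem v_eq : T.v = sandwichLeft k (1 : A) (T.J : A ⊗[k] A) := by
  rw [v, sandwichLeft, LinearMap.comp_apply, LinearMap.rTensor]; simp

theorem vInv_eq : T.vInv = sandwichRight k (1 : A) (↑T.J⁻¹ : A ⊗[k] A) := by
  rw [vInv, sandwichRight, LinearMap.comp_apply, LinearMap.lTensor]; simp

/-- `(a ⊗ b) ⊗ c ↦ S(a) b S(c)`. -/
noncomputable def tripleLeft (k A : Type*) [Field k] [Ring A] [HopfAlgebra k A] :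
    (A ⊗[k] A) ⊗[k] A →ₗ[k] A :=
  LinearMap.mul' k A ∘ₗ TensorProduct.map (sandwichLeft k 1) (HopfAlgebra.antipode k)

/-- `a ⊗ (b ⊗ c) ↦ a S(b) c`. -/
noncomputable def tripleRight (k A : Type*) [Field k] [Ring A] [HopfAlgebra k A] :
    A ⊗[k] (A ⊗[k] A) →ₗ[k] A :=
  LinearMap.mul' k A ∘ₗ TensorProduct.map LinearMap.id (sandwichLeft k 1)

theorem tripleLeft_aux (X Y : A ⊗[k] A) (p q : A) :
    tripleLeft k A ((X ⊗ₜ[k] p) *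
        (Algebra.TensorProduct.assoc k k k A A A).symm (q ⊗ₜ[k] Y)) =
      HopfAlgebra.antipode k q * sandwichLeft k 1 X * sandwichRight k 1 Y *
        HopfAlgebra.antipode k p := by
  induction X with
  | zero => simp
  | add X Z hX hZ => simp only [TensorProduct.add_tmul, add_mul, map_add, hX, hZ, mul_add]
  | tmul a b =>
    induction Y with
    | zero => simp
    | add Y Z hY hZ => simp only [TensorProduct.tmul_add, mul_add, map_add, hY, hZ, add_mul]
    | tmul c d =>
      simp [tripleLeft, sandwichLeft_tmul, sandwichRight_tmul,
        HopfAlgebra.antipode_mul_antidistrib, mul_assoc]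

theorem tripleRight_aux (X Y : A ⊗[k] A) (p q : A) :
    tripleRight k A ((p ⊗ₜ[k] X) *
        Algebra.TensorProduct.assoc k k k A A A (Y ⊗ₜ[k] q)) =
      p * sandwichRight k 1 Y * sandwichLeft k 1 X * q := by
  induction X with
  | zero => simp
  | add X Z hX hZ => simp only [TensorProduct.tmul_add, add_mul, map_add, hX, hZ, mul_add]
  | tmul a b =>
    induction Y with
    | zero => simp
    | add Y Z hY hZ => simp only [TensorProduct.add_tmul, mul_add, map_add, hY, hZ, add_mul]
    | tmul c d =>
      simp [tripleRight, sandwichLeft_tmul, sandwichRight_tmul,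
        HopfAlgebra.antipode_mul_antidistrib, mul_assoc]

theorem tripleLeft_map (P Q : A ⊗[k] A) :
    tripleLeft k A
        (Algebra.TensorProduct.map (Bialgebra.comulAlgHom k A) (AlgHom.id k A) P *
        (Algebra.TensorProduct.assoc k k k A A A).symm
          (Algebra.TensorProduct.map (AlgHom.id k A) (Bialgebra.comulAlgHom k A) Q)) =
      HopfAlgebra.antipode k (Algebra.TensorProduct.rid k k A
        (Algebra.TensorProduct.map (AlgHom.id k A) (Bialgebra.counitAlgHom k A) Q)) *
      HopfAlgebra.antipode k (Algebra.TensorProduct.lid k A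
        (Algebra.TensorProduct.map (Bialgebra.counitAlgHom k A) (AlgHom.id k A) P)) := by
  induction P with
  | zero => simp
  | add X Z hX hZ => simp only [map_add, add_mul, hX, hZ, mul_add]
  | tmul a b =>
    induction Q with
    | zero => simp
    | add X Z hX hZ => simp only [map_add, add_mul, hX, hZ, mul_add]
    | tmul c d =>
      rw [Algebra.TensorProduct.map_tmul, Algebra.TensorProduct.map_tmul, AlgHom.id_apply,
        AlgHom.id_apply, tripleLeft_aux]
      simp [sandwichLeft_comul, sandwichRight_comul, smul_smul, mul_comm]

theorem tripleRight_map (P Q : A ⊗[k] A) :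
    tripleRight k A
        (Algebra.TensorProduct.map (AlgHom.id k A) (Bialgebra.comulAlgHom k A) P *
        Algebra.TensorProduct.assoc k k k A A A
          (Algebra.TensorProduct.map (Bialgebra.comulAlgHom k A) (AlgHom.id k A) Q)) =
      (Algebra.TensorProduct.rid k k A
        (Algebra.TensorProduct.map (AlgHom.id k A) (Bialgebra.counitAlgHom k A) P)) *
      (Algebra.TensorProduct.lid k A
        (Algebra.TensorProduct.map (Bialgebra.counitAlgHom k A) (AlgHom.id k A) Q)) := by
  induction P with
  | zero => simp
  | add X Z hX hZ => simp only [map_add, add_mul, hX, hZ]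
  | tmul a b =>
    induction Q with
    | zero => simp
    | add X Z hX hZ => simp only [map_add, mul_add, hX, hZ]
    | tmul c d =>
      rw [Algebra.TensorProduct.map_tmul, Algebra.TensorProduct.map_tmul, AlgHom.id_apply,
        AlgHom.id_apply, tripleRight_aux]
      simp [sandwichLeft_comul, sandwichRight_comul, smul_smul, mul_comm]

theorem counit_left_inv :
    Algebra.TensorProduct.lid k A
      (Algebra.TensorProduct.map (Bialgebra.counitAlgHom k A) (AlgHom.id k A)
        (↑T.J⁻¹ : A ⊗[k] A)) = 1 := by
  have h := congrArg (fun x => Algebra.TensorProduct.lid k A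
      (Algebra.TensorProduct.map (Bialgebra.counitAlgHom k A) (AlgHom.id k A) x)) T.J.mul_inv
  simpa only [map_mul, T.counit_left, one_mul, map_one] using h

theorem counit_right_inv :
    Algebra.TensorProduct.rid k k A
      (Algebra.TensorProduct.map (AlgHom.id k A) (Bialgebra.counitAlgHom k A)
        (↑T.J⁻¹ : A ⊗[k] A)) = 1 := by
  have h := congrArg (fun x => Algebra.TensorProduct.rid k k A
      (Algebra.TensorProduct.map (AlgHom.id k A) (Bialgebra.counitAlgHom k A) x)) T.J.mul_inv
  simpa only [map_mul, T.counit_right, one_mul, map_one] using h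

theorem v_mul_vInv : T.v * T.vInv = 1 := by
  have hL : ∀ X Y : A ⊗[k] A, tripleLeft k A ((X ⊗ₜ[k] (1 : A)) *
      (Algebra.TensorProduct.assoc k k k A A A).symm ((1 : A) ⊗ₜ[k] Y)) =
        sandwichLeft k 1 X * sandwichRight k 1 Y := fun X Y => by
    rw [tripleLeft_aux]; simp
  have key : ((T.J : A ⊗[k] A) ⊗ₜ[k] (1 : A)) *
      (Algebra.TensorProduct.assoc k k k A A A).symm ((1 : A) ⊗ₜ[k] (↑T.J⁻¹ : A ⊗[k] A)) =
      Algebra.TensorProduct.map (Bialgebra.comulAlgHom k A) (AlgHom.id k A)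
        (↑T.J⁻¹ : A ⊗[k] A) *
        (Algebra.TensorProduct.assoc k k k A A A).symm
          (Algebra.TensorProduct.map (AlgHom.id k A) (Bialgebra.comulAlgHom k A)
            (T.J : A ⊗[k] A)) := by
    have h := congrArg (Algebra.TensorProduct.assoc k k k A A A).symm T.cocycle
    rw [AlgEquiv.symm_apply_apply, map_mul] at h
    have h1 : Algebra.TensorProduct.map (Bialgebra.comulAlgHom k A) (AlgHom.id k A)
          (↑T.J⁻¹ : A ⊗[k] A) *
        Algebra.TensorProduct.map (Bialgebra.comulAlgHom k A) (AlgHom.id k A)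
          (T.J : A ⊗[k] A) = 1 := by rw [← map_mul, T.J.inv_mul, map_one]
    have h2 : (Algebra.TensorProduct.assoc k k k A A A).symm
          ((1 : A) ⊗ₜ[k] (T.J : A ⊗[k] A)) *
        (Algebra.TensorProduct.assoc k k k A A A).symm
          ((1 : A) ⊗ₜ[k] (↑T.J⁻¹ : A ⊗[k] A)) = 1 := by
      rw [← map_mul, Algebra.TensorProduct.tmul_mul_tmul, T.J.mul_inv, one_mul,
        ← Algebra.TensorProduct.one_def, map_one]
    calc
      _ = (1 * ((T.J : A ⊗[k] A) ⊗ₜ[k] (1 : A))) *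
          (Algebra.TensorProduct.assoc k k k A A A).symm
            ((1 : A) ⊗ₜ[k] (↑T.J⁻¹ : A ⊗[k] A)) := by rw [one_mul]
      _ = _ := by rw [← h1, mul_assoc _ _ ((T.J : A ⊗[k] A) ⊗ₜ[k] (1 : A)), h,
                    mul_assoc, mul_assoc, h2, mul_one]
  rw [v_eq, vInv_eq, ← hL, key, tripleLeft_map, T.counit_right, T.counit_left_inv]
  simp

theorem vInv_mul_v : T.vInv * T.v = 1 := by
  have hL : ∀ X Y : A ⊗[k] A, tripleRight k A (((1 : A) ⊗ₜ[k] X) *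
      (Algebra.TensorProduct.assoc k k k A A A) (Y ⊗ₜ[k] (1 : A))) =
        sandwichRight k 1 Y * sandwichLeft k 1 X := fun X Y => by
    rw [tripleRight_aux]; simp
  have key : ((1 : A) ⊗ₜ[k] (T.J : A ⊗[k] A)) *
      (Algebra.TensorProduct.assoc k k k A A A) ((↑T.J⁻¹ : A ⊗[k] A) ⊗ₜ[k] (1 : A)) =
      Algebra.TensorProduct.map (AlgHom.id k A) (Bialgebra.comulAlgHom k A)
        (↑T.J⁻¹ : A ⊗[k] A) *
        (Algebra.TensorProduct.assoc k k k A A A)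
          (Algebra.TensorProduct.map (Bialgebra.comulAlgHom k A) (AlgHom.id k A)
            (T.J : A ⊗[k] A)) := by
    have h := T.cocycle
    rw [map_mul] at h
    have h1 : Algebra.TensorProduct.map (AlgHom.id k A) (Bialgebra.comulAlgHom k A)
          (↑T.J⁻¹ : A ⊗[k] A) *
        Algebra.TensorProduct.map (AlgHom.id k A) (Bialgebra.comulAlgHom k A)
          (T.J : A ⊗[k] A) = 1 := by rw [← map_mul, T.J.inv_mul, map_one]
    have h2 : (Algebra.TensorProduct.assoc k k k A A A)
          ((T.J : A ⊗[k] A) ⊗ₜ[k] (1 : A)) *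
        (Algebra.TensorProduct.assoc k k k A A A)
          ((↑T.J⁻¹ : A ⊗[k] A) ⊗ₜ[k] (1 : A)) = 1 := by
      rw [← map_mul, Algebra.TensorProduct.tmul_mul_tmul, T.J.mul_inv, one_mul,
        ← Algebra.TensorProduct.one_def, map_one]
    calc
      _ = (1 * ((1 : A) ⊗ₜ[k] (T.J : A ⊗[k] A))) *
          (Algebra.TensorProduct.assoc k k k A A A)
            ((↑T.J⁻¹ : A ⊗[k] A) ⊗ₜ[k] (1 : A)) := by rw [one_mul]
      _ = _ := by rw [← h1, mul_assoc _ _ ((1 : A) ⊗ₜ[k] (T.J : A ⊗[k] A)), ← h,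
                    mul_assoc, mul_assoc, h2, mul_one]
  rw [v_eq, vInv_eq, ← hL, key, tripleRight_map, T.counit_left, T.counit_right_inv]
  simp

/-- `S^J(h) = v⁻¹ S(h) v`. -/
noncomputable def antipodeTwist : A →ₗ[k] A :=
  LinearMap.mulLeft k T.vInv ∘ₗ LinearMap.mulRight k T.v ∘ₗ HopfAlgebra.antipode k

theorem antipodeTwist_apply (h : A) :
    T.antipodeTwist h = T.vInv * (HopfAlgebra.antipode k h * T.v) := rfl

theorem antipodeTwist_left (h : A) :
    LinearMap.mul' k A (T.antipodeTwist.rTensor A (T.comulTwist h)) =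
      algebraMap k A (Coalgebra.counit h) := by
  have h1 : ∀ X : A ⊗[k] A, LinearMap.mul' k A (T.antipodeTwist.rTensor A X) =
      T.vInv * sandwichLeft k T.v X := fun X => by
    induction X with
    | zero => simp
    | add X Y hX hY => simp only [map_add, hX, hY, mul_add]
    | tmul a b => simp [antipodeTwist_apply, sandwichLeft_tmul, mul_assoc]
  have h2 : sandwichLeft k T.v (↑T.J⁻¹ : A ⊗[k] A) = 1 := by
    rw [v_eq, ← sandwichLeft_mul, T.J.mul_inv, sandwichLeft_one]
  rw [h1, comulTwist_apply, sandwichLeft_mul, h2, sandwichLeft_mul, sandwichLeft_comul,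
    sandwichLeft_smul, ← v_eq, mul_smul_comm, vInv_mul_v, Algebra.algebraMap_eq_smul_one]

theorem antipodeTwist_right (h : A) :
    LinearMap.mul' k A (T.antipodeTwist.lTensor A (T.comulTwist h)) =
      algebraMap k A (Coalgebra.counit h) := by
  have h1 : ∀ X : A ⊗[k] A, LinearMap.mul' k A (T.antipodeTwist.lTensor A X) =
      sandwichRight k T.vInv X * T.v := fun X => by
    induction X with
    | zero => simp
    | add X Y hX hY => simp only [map_add, hX, hY, add_mul]
    | tmul a b => simp [antipodeTwist_apply, sandwichRight_tmul, mul_assoc]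
  have h2 : sandwichRight k T.vInv (T.J : A ⊗[k] A) = 1 := by
    rw [vInv_eq, ← sandwichRight_mul, T.J.mul_inv, sandwichRight_one]
  rw [h1, comulTwist_apply, sandwichRight_mul, sandwichRight_mul, h2, sandwichRight_comul,
    sandwichRight_smul, ← vInv_eq, smul_mul_assoc, vInv_mul_v, Algebra.algebraMap_eq_smul_one]

theorem comulTwist_coassoc :
    (Algebra.TensorProduct.assoc k k k A A A).toAlgHom.comp
      ((Algebra.TensorProduct.map T.comulTwist (.id k A)).comp T.comulTwist) =
    (Algebra.TensorProduct.map (.id k A) T.comulTwist).comp T.comulTwist := by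
  have hl : ∀ X : A ⊗[k] A, Algebra.TensorProduct.map T.comulTwist (.id k A) X =
      ((↑T.J⁻¹ : A ⊗[k] A) ⊗ₜ[k] (1 : A)) *
        (Algebra.TensorProduct.map (Bialgebra.comulAlgHom k A) (AlgHom.id k A) X *
          ((T.J : A ⊗[k] A) ⊗ₜ[k] (1 : A))) := fun X => by
    induction X with
    | zero => simp
    | add X Y hX hY => simp only [map_add, hX, hY, add_mul, mul_add]
    | tmul a b => simp [comulTwist_apply]
  have hr : ∀ X : A ⊗[k] A, Algebra.TensorProduct.map (.id k A) T.comulTwist X =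
      ((1 : A) ⊗ₜ[k] (↑T.J⁻¹ : A ⊗[k] A)) *
        (Algebra.TensorProduct.map (AlgHom.id k A) (Bialgebra.comulAlgHom k A) X *
          ((1 : A) ⊗ₜ[k] (T.J : A ⊗[k] A))) := fun X => by
    induction X with
    | zero => simp
    | add X Y hX hY => simp only [map_add, hX, hY, add_mul, mul_add]
    | tmul a b => simp [comulTwist_apply]
  have hco : ∀ h : A, Algebra.TensorProduct.assoc k k k A A A
      (Algebra.TensorProduct.map (Bialgebra.comulAlgHom k A) (AlgHom.id k A)
        (Coalgebra.comul h)) =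
      Algebra.TensorProduct.map (AlgHom.id k A) (Bialgebra.comulAlgHom k A)
        (Coalgebra.comul h) := fun h => Coalgebra.coassoc_apply h
  have hc := T.cocycle
  -- the inverse of the cocycle identity
  have hci : Algebra.TensorProduct.assoc k k k A A A
        (((↑T.J⁻¹ : A ⊗[k] A) ⊗ₜ[k] (1 : A)) *
        Algebra.TensorProduct.map (Bialgebra.comulAlgHom k A) (AlgHom.id k A)
          (↑T.J⁻¹ : A ⊗[k] A)) =
      ((1 : A) ⊗ₜ[k] (↑T.J⁻¹ : A ⊗[k] A)) *
      Algebra.TensorProduct.map (AlgHom.id k A) (Bialgebra.comulAlgHom k A)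
        (↑T.J⁻¹ : A ⊗[k] A) := by
    refine left_inv_eq_right_inv (a := Algebra.TensorProduct.assoc k k k A A A
        (Algebra.TensorProduct.map (Bialgebra.comulAlgHom k A) (AlgHom.id k A) (T.J : A ⊗[k] A) *
          ((T.J : A ⊗[k] A) ⊗ₜ[k] (1 : A)))) ?_ ?_
    · rw [← map_mul, mul_assoc, ← mul_assoc (Algebra.TensorProduct.map _ _ _)
        (Algebra.TensorProduct.map _ _ _), ← map_mul, T.J.inv_mul, map_one, one_mul,
        Algebra.TensorProduct.tmul_mul_tmul, T.J.inv_mul, one_mul,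
        ← Algebra.TensorProduct.one_def, map_one]
    · rw [hc, mul_assoc, ← mul_assoc ((1 : A) ⊗ₜ[k] (T.J : A ⊗[k] A)),
        Algebra.TensorProduct.tmul_mul_tmul, T.J.mul_inv, one_mul,
        ← Algebra.TensorProduct.one_def, one_mul, ← map_mul, T.J.mul_inv, map_one]
  apply AlgHom.ext
  intro h
  change Algebra.TensorProduct.assoc k k k A A A
      (Algebra.TensorProduct.map T.comulTwist (.id k A) (T.comulTwist h)) =
    Algebra.TensorProduct.map (.id k A) T.comulTwist (T.comulTwist h)
  rw [hl, hr, comulTwist_apply, map_mul (Algebra.TensorProduct.map _ _),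
    map_mul (Algebra.TensorProduct.map _ _), map_mul (Algebra.TensorProduct.map _ _),
    map_mul (Algebra.TensorProduct.map _ _), ← hco]
  calc _ = Algebra.TensorProduct.assoc k k k A A A
        ((((↑T.J⁻¹ : A ⊗[k] A) ⊗ₜ[k] (1 : A)) *
        Algebra.TensorProduct.map (Bialgebra.comulAlgHom k A) (AlgHom.id k A)
          (↑T.J⁻¹ : A ⊗[k] A)) *
        (Algebra.TensorProduct.map (Bialgebra.comulAlgHom k A) (AlgHom.id k A)
          (Coalgebra.comul h) *
        (Algebra.TensorProduct.map (Bialgebra.comulAlgHom k A) (AlgHom.id k A)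
          (T.J : A ⊗[k] A) * ((T.J : A ⊗[k] A) ⊗ₜ[k] (1 : A))))) := by
        simp only [mul_assoc]
    _ = _ := by rw [map_mul, hci, map_mul, hc]; simp only [mul_assoc]

theorem comulTwist_counit_left :
    (Algebra.TensorProduct.map (Bialgebra.counitAlgHom k A) (.id k A)).comp T.comulTwist =
      (Algebra.TensorProduct.lid k A).symm := by
  apply AlgHom.ext
  intro h
  apply (Algebra.TensorProduct.lid k A).injective
  have h0 : Algebra.TensorProduct.map (Bialgebra.counitAlgHom k A) (AlgHom.id k A)
      (Coalgebra.comul h) = (1 : k) ⊗ₜ[k] h := Coalgebra.rTensor_counit_comul h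
  rw [AlgHom.comp_apply, comulTwist_apply, map_mul, map_mul, map_mul, map_mul, T.counit_left,
    T.counit_left_inv, h0]
  simp

theorem comulTwist_counit_right :
    (Algebra.TensorProduct.map (.id k A) (Bialgebra.counitAlgHom k A)).comp T.comulTwist =
      (Algebra.TensorProduct.rid k k A).symm := by
  apply AlgHom.ext
  intro h
  apply (Algebra.TensorProduct.rid k k A).injective
  have h0 : Algebra.TensorProduct.map (AlgHom.id k A) (Bialgebra.counitAlgHom k A)
      (Coalgebra.comul h) = h ⊗ₜ[k] (1 : k) := Coalgebra.lTensor_counit_comul h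
  rw [AlgHom.comp_apply, comulTwist_apply, map_mul, map_mul, map_mul, map_mul, T.counit_right,
    T.counit_right_inv, h0]
  simp

end Construction

/-- The underlying type of the twisted Hopf algebra `A^J`: it is `A`. -/
def Twisted {k A : Type*} [Field k] [Ring A] [HopfAlgebra k A] (_T : HopfTwist k A) : Type _ := A

variable {k A : Type*} [Field k] [Ring A] [HopfAlgebra k A] (T : HopfTwist k A)

/-- `A^J` has the multiplication of `A`. -/
noncomputable instance : Ring T.Twisted := inferInstanceAs (Ring A)

/-- `A^J` is the bialgebra `(A, m, Δ^J, ε)`. -/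
noncomputable instance : Bialgebra k T.Twisted :=
  letI : Bialgebra k A := Bialgebra.ofAlgHom T.comulTwist (Bialgebra.counitAlgHom k A)
    T.comulTwist_coassoc T.comulTwist_counit_left T.comulTwist_counit_right
  inferInstanceAs (Bialgebra k A)

/-- `A^J` is the Hopf algebra `(A, m, Δ^J, ε, S^J)`. -/
noncomputable instance : HopfAlgebra k T.Twisted where
  antipode := T.antipodeTwist
  mul_antipode_rTensor_comul := LinearMap.ext fun h => T.antipodeTwist_left h
  mul_antipode_lTensor_comul := LinearMap.ext fun h => T.antipodeTwist_right h

theorem twisted_comul (h : A) :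
    Coalgebra.comul (R := k) (A := T.Twisted) h =
      ((↑T.J⁻¹ : A ⊗[k] A) * (Coalgebra.comul h * (T.J : A ⊗[k] A)) : A ⊗[k] A) := rfl

theorem twisted_counit (h : A) :
    Coalgebra.counit (R := k) (A := T.Twisted) h = Coalgebra.counit (R := k) (A := A) h := rfl

theorem twisted_antipode (h : A) :
    HopfAlgebra.antipode k (A := T.Twisted) h =
      T.vInv * (HopfAlgebra.antipode k h * T.v) := rfl

end HopfTwist

/-! ### Normal Hopf subalgebras and simplicity -/

section Simple

variable (k : Type*) {A : Type*} [Field k] [Ring A] [HopfAlgebra k A]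

/-- The left adjoint action `ad(h)(x) = ∑ h₁ x S(h₂)`. -/
noncomputable def leftAdjoint (h x : A) : A :=
  LinearMap.mul' k A
    (TensorProduct.map (LinearMap.mulRight k x) (HopfAlgebra.antipode k) (Coalgebra.comul h))

variable {k}

/-- A Hopf subalgebra: a subalgebra `K` with `Δ(K) ⊆ K ⊗ K` and `S(K) ⊆ K`. -/
structure IsHopfSubalgebra (K : Subalgebra k A) : Prop where
  comul_mem : ∀ x ∈ K, Coalgebra.comul (R := k) x ∈
    LinearMap.range (TensorProduct.map K.val.toLinearMap K.val.toLinearMap)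
  antipode_mem : ∀ x ∈ K, HopfAlgebra.antipode k x ∈ K

/-- A subalgebra that is stable under the left adjoint action. -/
def IsAdjointStable (K : Subalgebra k A) : Prop :=
  ∀ h : A, ∀ x ∈ K, leftAdjoint k h x ∈ K

variable (k A)

/-- A Hopf algebra is simple if it is not the base field and has no normal Hopf subalgebras other
than the base field and itself. -/
structure IsSimpleHopfAlgebra : Prop where
  bot_ne_top : (⊥ : Subalgebra k A) ≠ ⊤
  eq_bot_or_eq_top : ∀ K : Subalgebra k A, IsHopfSubalgebra K → IsAdjointStable K →
    K = ⊥ ∨ K = ⊤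

end Simple

/-! ### Twists of a group algebra lifted from a finite abelian subgroup -/

section Bicharacter

attribute [local instance] Fintype.ofFinite

open MonoidAlgebra

variable {k G : Type*} [Field k] [Group G] {H : Subgroup G} [Finite H]

/-- The element `e_χ = |H|⁻¹ ∑_{h ∈ H} χ(h⁻¹) h` of the group algebra `kG`, for a character `χ`
of the finite subgroup `H` of `G`. -/
noncomputable def charIdempotent (χ : H →* kˣ) : MonoidAlgebra k G :=
  (Nat.card H : k)⁻¹ • ∑ h : H, single (h : G) ((χ h⁻¹ : kˣ) : k)

/-- The element `∑_{α, β} ω(α, β) e_α ⊗ e_β` of `kG ⊗ kG`. -/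
noncomputable def bicharElement (ω : (H →* kˣ) →* (H →* kˣ) →* kˣ) :
    MonoidAlgebra k G ⊗[k] MonoidAlgebra k G :=
  ∑ α : H →* kˣ, ∑ β : H →* kˣ, ((ω α β : kˣ) : k) • (charIdempotent α ⊗ₜ[k] charIdempotent β)

theorem single_mul_charIdempotent (g : H) (χ : H →* kˣ) :
    single (g : G) (1 : k) * charIdempotent χ = ((χ g : kˣ) : k) • charIdempotent χ := by
  rw [charIdempotent, mul_smul_comm, smul_comm ((χ g : kˣ) : k), Finset.mul_sum,
    Finset.smul_sum (r := ((χ g : kˣ) : k))]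
  refine congrArg _ (Fintype.sum_equiv (Equiv.mulLeft g) _ _ fun h => ?_)
  rw [single_mul_single, smul_single, one_mul, Equiv.coe_mulLeft, Subgroup.coe_mul, smul_eq_mul,
    ← Units.val_mul, ← map_mul, mul_inv_rev]
  have : χ (g * (h⁻¹ * g⁻¹)) = χ h⁻¹ := by simp
  rw [this]

theorem charIdempotent_mul [CharZero k] (α β : H →* kˣ) [Decidable (α = β)] :
    (charIdempotent α * charIdempotent β : MonoidAlgebra k G) =
      if α = β then charIdempotent α else 0 := by
  have h0 : (Nat.card H : k) ≠ 0 := Nat.cast_ne_zero.mpr Nat.card_pos.ne'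
  have h1 : (charIdempotent α * charIdempotent β : MonoidAlgebra k G) =
      ((Nat.card H : k)⁻¹ * ∑ h : H, (((β * α⁻¹) h : kˣ) : k)) • charIdempotent β := by
    conv_lhs => rw [charIdempotent, smul_mul_assoc, Finset.sum_mul]
    rw [mul_smul, Finset.sum_smul]
    congr 1
    refine Finset.sum_congr rfl fun h _ => ?_
    have : (single (h : G) ((α h⁻¹ : kˣ) : k) : MonoidAlgebra k G) =
        ((α h⁻¹ : kˣ) : k) • single (h : G) (1 : k) := by simp
    rw [this, smul_mul_assoc, single_mul_charIdempotent, smul_smul, ← Units.val_mul]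
    simp [mul_comm]
  rw [h1]
  split_ifs with h
  · subst h
    simp [← Nat.card_eq_fintype_card, h0]
  · have h2 := sum_hom_units_eq_zero ((Units.coeHom k).comp (β * α⁻¹)) fun hc => h (by
      ext x
      have := DFunLike.congr_fun hc x
      have h3 : (β * α⁻¹) x = 1 := Units.ext (by simpa using this)
      rw [MonoidHom.mul_apply, MonoidHom.inv_apply, mul_inv_eq_one] at h3
      rw [h3])
    have h4 : ∑ h : H, (((β * α⁻¹) h : kˣ) : k) = 0 := h2
    rw [h4]; simp

open scoped IsMulCommutative in
theorem sum_dual_apply [IsMulCommutative H] [IsAlgClosed k] [CharZero k] (g : H)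
    [Decidable (g = 1)] :
    ∑ χ : H →* kˣ, ((χ g : kˣ) : k) = if g = 1 then (Nat.card H : k) else 0 := by
  split_ifs with h
  · subst h
    have := CommGroup.card_monoidHom_of_hasEnoughRootsOfUnity H k
    simp [← Nat.card_eq_fintype_card, this]
  · obtain ⟨φ, hφ⟩ := CommGroup.exists_apply_ne_one_of_hasEnoughRootsOfUnity H k h
    let ev : (H →* kˣ) →* k :=
      { toFun := fun χ => ((χ g : kˣ) : k)
        map_one' := by simp
        map_mul' := by simp }
    refine sum_hom_units_eq_zero ev fun hc => hφ ?_
    have := DFunLike.congr_fun hc φ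
    exact Units.ext (by simpa [ev] using this)

theorem sum_smul_charIdempotent [IsMulCommutative H] [IsAlgClosed k] [CharZero k] (g : H) :
    ∑ χ : H →* kˣ, ((χ g : kˣ) : k) • (charIdempotent χ : MonoidAlgebra k G) =
      single (g : G) (1 : k) := by
  classical
  have h0 : (Nat.card H : k) ≠ 0 := Nat.cast_ne_zero.mpr Nat.card_pos.ne'
  simp only [charIdempotent]
  have h1 : ∀ χ : H →* kˣ, ((χ g : kˣ) : k) • ((Nat.card H : k)⁻¹ •
      ∑ h : H, (single (h : G) ((χ h⁻¹ : kˣ) : k) : MonoidAlgebra k G)) =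
      (Nat.card H : k)⁻¹ • ∑ h : H, ((χ (g * h⁻¹) : kˣ) : k) • single (h : G) (1 : k) := by
    intro χ
    rw [smul_comm, Finset.smul_sum]
    congr 1
    refine Finset.sum_congr rfl fun h _ => ?_
    simp
  rw [Finset.sum_congr rfl fun χ _ => h1 χ, ← Finset.smul_sum, Finset.sum_comm]
  simp only [← Finset.sum_smul, sum_dual_apply]
  rw [Finset.sum_eq_single g]
  · simp
  · intro b _ hb
    rw [if_neg, zero_smul]
    rw [mul_inv_eq_one]
    exact fun h => hb h.symm
  · simp

theorem sum_charIdempotent [IsMulCommutative H] [IsAlgClosed k] [CharZero k] :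
    ∑ χ : H →* kˣ, (charIdempotent χ : MonoidAlgebra k G) = 1 := by
  simpa [one_def] using sum_smul_charIdempotent (k := k) (1 : H)

theorem counit_charIdempotent [CharZero k] (χ : H →* kˣ) [Decidable (χ = 1)] :
    Coalgebra.counit (R := k) (charIdempotent χ : MonoidAlgebra k G) = if χ = 1 then 1 else 0 := by
  have h0 : (Nat.card H : k) ≠ 0 := Nat.cast_ne_zero.mpr Nat.card_pos.ne'
  have h1 : Coalgebra.counit (R := k) (charIdempotent χ : MonoidAlgebra k G) =
      (Nat.card H : k)⁻¹ * ∑ h : H, ((χ⁻¹ h : kˣ) : k) := by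
    simp [charIdempotent]
  rw [h1]
  split_ifs with h
  · subst h
    simp [← Nat.card_eq_fintype_card]
  · have h2 := sum_hom_units_eq_zero ((Units.coeHom k).comp χ⁻¹) fun hc => h (by
      ext x
      have := DFunLike.congr_fun hc x
      have h3 : χ⁻¹ x = 1 := Units.ext (by simpa using this)
      rw [MonoidHom.inv_apply, inv_eq_one] at h3
      rw [h3]; rfl)
    have h4 : ∑ h : H, ((χ⁻¹ h : kˣ) : k) = 0 := h2
    rw [h4, mul_zero]

theorem comul_charIdempotent [IsMulCommutative H] [IsAlgClosed k] [CharZero k] (χ : H →* kˣ) :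
    Coalgebra.comul (R := k) (charIdempotent χ : MonoidAlgebra k G) =
      ∑ α : H →* kˣ, charIdempotent α ⊗ₜ[k] charIdempotent (α⁻¹ * χ) := by
  classical
  have h0 : (Nat.card H : k) ≠ 0 := Nat.cast_ne_zero.mpr Nat.card_pos.ne'
  have h1 : ∀ h : H, Coalgebra.comul (R := k)
      (single (h : G) ((χ h⁻¹ : kˣ) : k) : MonoidAlgebra k G) =
      ∑ α : H →* kˣ, ∑ β : H →* kˣ, (((α * β * χ⁻¹) h : kˣ) : k) •
        (charIdempotent α ⊗ₜ[k] charIdempotent β : MonoidAlgebra k G ⊗[k] MonoidAlgebra k G) := by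
    intro h
    have : (single (h : G) ((χ h⁻¹ : kˣ) : k) : MonoidAlgebra k G) =
        ((χ h⁻¹ : kˣ) : k) • single (h : G) (1 : k) := by simp
    have h2 : Coalgebra.comul (R := k) (single (h : G) (1 : k) : MonoidAlgebra k G) =
        single (h : G) (1 : k) ⊗ₜ[k] single (h : G) (1 : k) := by simp
    rw [this, map_smul, h2, ← sum_smul_charIdempotent h, TensorProduct.sum_tmul,
      Finset.smul_sum]
    refine Finset.sum_congr rfl fun α _ => ?_
    rw [TensorProduct.tmul_sum, Finset.smul_sum]
    refine Finset.sum_congr rfl fun β _ => ?_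
    rw [TensorProduct.smul_tmul_smul, smul_smul]
    congr 1
    simp only [MonoidHom.mul_apply, MonoidHom.inv_apply, map_inv, Units.val_mul]
    ring
  have h2 : ∀ α β : H →* kˣ, ∑ h : H, (((α * β * χ⁻¹) h : kˣ) : k) =
      if β = α⁻¹ * χ then (Nat.card H : k) else 0 := by
    intro α β
    split_ifs with h
    · subst h
      simp [← Nat.card_eq_fintype_card]
    · refine sum_hom_units_eq_zero ((Units.coeHom k).comp (α * β * χ⁻¹)) fun hc => h ?_
      have h3 : α * β * χ⁻¹ = 1 := by
        ext x
        simpa using DFunLike.congr_fun hc x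
      have h4 : α * β = χ := mul_inv_eq_one.mp h3
      rw [← h4]
      exact (inv_mul_cancel_left α β).symm
  conv_lhs => rw [charIdempotent]
  rw [map_smul, map_sum, Finset.sum_congr rfl fun h _ => h1 h, Finset.sum_comm, Finset.smul_sum]
  refine Finset.sum_congr rfl fun α _ => ?_
  rw [Finset.sum_comm, Finset.sum_congr rfl fun β _ => (Finset.sum_smul).symm]
  simp only [h2, ite_smul, zero_smul, Finset.sum_ite_eq', Finset.mem_univ, if_true]
  rw [smul_smul, inv_mul_cancel₀ h0, one_smul]

theorem sum_tmul_mul_sum_tmul [CharZero k] (f g : (H →* kˣ) → (H →* kˣ) → k) :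
    (∑ α : H →* kˣ, ∑ β : H →* kˣ, f α β • (charIdempotent α ⊗ₜ[k] charIdempotent β :
        MonoidAlgebra k G ⊗[k] MonoidAlgebra k G)) *
      (∑ α : H →* kˣ, ∑ β : H →* kˣ, g α β • (charIdempotent α ⊗ₜ[k] charIdempotent β)) =
      ∑ α : H →* kˣ, ∑ β : H →* kˣ, (f α β * g α β) •
        (charIdempotent α ⊗ₜ[k] charIdempotent β) := by
  classical
  simp only [Finset.sum_mul]
  refine Finset.sum_congr rfl fun α _ => Finset.sum_congr rfl fun β _ => ?_
  simp only [Finset.mul_sum, smul_mul_smul_comm, Algebra.TensorProduct.tmul_mul_tmul,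
    charIdempotent_mul]
  rw [Finset.sum_eq_single α]
  · rw [Finset.sum_eq_single β]
    · simp
    · intro b _ hb; simp [hb.symm]
    · simp
  · intro b _ hb; simp [hb.symm]
  · simp

theorem sum_tmul_eq_one [IsMulCommutative H] [IsAlgClosed k] [CharZero k] :
    ∑ α : H →* kˣ, ∑ β : H →* kˣ, (1 : k) • (charIdempotent α ⊗ₜ[k] charIdempotent β :
        MonoidAlgebra k G ⊗[k] MonoidAlgebra k G) = 1 := by
  simp only [one_smul, ← TensorProduct.tmul_sum, ← TensorProduct.sum_tmul, sum_charIdempotent]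
  rfl

/-- The twist `J = ∑_{α, β} ω(α, β) e_α ⊗ e_β` of the group algebra `kG` lifted from the finite
abelian subgroup `H`, for a bicharacter `ω` on the dual group of `H`. -/
noncomputable def bicharTwist [IsMulCommutative H] [IsAlgClosed k] [CharZero k]
    (ω : (H →* kˣ) →* (H →* kˣ) →* kˣ) : HopfTwist k (MonoidAlgebra k G) where
  J :=
    { val := bicharElement ω
      inv := bicharElement ω⁻¹
      val_inv := by
        rw [bicharElement, bicharElement, sum_tmul_mul_sum_tmul, ← sum_tmul_eq_one (H := H)]
        simp
      inv_val := by
        rw [bicharElement, bicharElement, sum_tmul_mul_sum_tmul, ← sum_tmul_eq_one (H := H)]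
        simp }
  cocycle := by
    classical
    change Algebra.TensorProduct.assoc k k k _ _ _
      (Algebra.TensorProduct.map _ _ (bicharElement ω) * (bicharElement ω ⊗ₜ[k] 1)) =
      Algebra.TensorProduct.map _ _ (bicharElement ω) * (1 ⊗ₜ[k] bicharElement ω)
    have hL : Algebra.TensorProduct.map (Bialgebra.comulAlgHom k (MonoidAlgebra k G))
        (AlgHom.id k (MonoidAlgebra k G)) (bicharElement ω) =
        ∑ α : H →* kˣ, ∑ β : H →* kˣ, ∑ γ : H →* kˣ, ((ω (α * β) γ : kˣ) : k) •
          ((charIdempotent α ⊗ₜ[k] charIdempotent β) ⊗ₜ[k] charIdempotent γ) := by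
      simp only [bicharElement, map_sum, map_smul, Algebra.TensorProduct.map_tmul,
        Bialgebra.comulAlgHom_apply, comul_charIdempotent, AlgHom.id_apply,
        TensorProduct.sum_tmul, Finset.smul_sum]
      rw [Finset.sum_congr rfl fun _ _ => Finset.sum_comm, Finset.sum_comm]
      refine Finset.sum_congr rfl fun α _ => ?_
      refine Fintype.sum_equiv (Equiv.mulLeft α⁻¹) _ _ fun χ => ?_
      have h1 : α * (α⁻¹ * χ) = χ := mul_inv_cancel_left α χ
      simp only [Equiv.coe_mulLeft, h1]
    have hR : Algebra.TensorProduct.map (AlgHom.id k (MonoidAlgebra k G))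
        (Bialgebra.comulAlgHom k (MonoidAlgebra k G)) (bicharElement ω) =
        ∑ α : H →* kˣ, ∑ β : H →* kˣ, ∑ γ : H →* kˣ, ((ω α (β * γ) : kˣ) : k) •
          (charIdempotent α ⊗ₜ[k] (charIdempotent β ⊗ₜ[k] charIdempotent γ)) := by
      simp only [bicharElement, map_sum, map_smul, Algebra.TensorProduct.map_tmul,
        Bialgebra.comulAlgHom_apply, comul_charIdempotent, AlgHom.id_apply,
        TensorProduct.tmul_sum, Finset.smul_sum]
      refine Finset.sum_congr rfl fun α _ => ?_
      rw [Finset.sum_comm]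
      refine Finset.sum_congr rfl fun β _ => ?_
      refine Fintype.sum_equiv (Equiv.mulLeft β⁻¹) _ _ fun χ => ?_
      have h1 : β * (β⁻¹ * χ) = χ := mul_inv_cancel_left β χ
      simp only [Equiv.coe_mulLeft, h1]
    have hmul : ∀ (f : (H →* kˣ) → (H →* kˣ) → k) (α β : H →* kˣ),
        (charIdempotent α ⊗ₜ[k] charIdempotent β :
          MonoidAlgebra k G ⊗[k] MonoidAlgebra k G) *
        (∑ α : H →* kˣ, ∑ β : H →* kˣ, f α β • (charIdempotent α ⊗ₜ[k] charIdempotent β)) =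
        f α β • (charIdempotent α ⊗ₜ[k] charIdempotent β) := by
      intro f α β
      simp only [Finset.mul_sum, mul_smul_comm, Algebra.TensorProduct.tmul_mul_tmul,
        charIdempotent_mul]
      rw [Finset.sum_eq_single α]
      · rw [Finset.sum_eq_single β]
        · simp
        · intro b _ hb; simp [hb.symm]
        · simp
      · intro b _ hb; simp [hb.symm]
      · simp
    rw [hL, hR]
    simp only [Finset.sum_mul, map_sum]
    refine Finset.sum_congr rfl fun α _ => Finset.sum_congr rfl fun β _ =>
      Finset.sum_congr rfl fun γ _ => ?_
    rw [smul_mul_assoc, smul_mul_assoc, Algebra.TensorProduct.tmul_mul_tmul,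
      Algebra.TensorProduct.tmul_mul_tmul, bicharElement, hmul, hmul, mul_one, mul_one,
      TensorProduct.tmul_smul, ← TensorProduct.smul_tmul', smul_smul, smul_smul, map_smul,
      Algebra.TensorProduct.assoc_tmul]
    congr 1
    simp only [map_mul, MonoidHom.mul_apply, Units.val_mul]
    ring
  counit_left := by
    classical
    change Algebra.TensorProduct.lid k _ (Algebra.TensorProduct.map _ _ (bicharElement ω)) = 1
    simp only [bicharElement, map_sum, map_smul, Algebra.TensorProduct.map_tmul,
      Bialgebra.counitAlgHom_apply, counit_charIdempotent, AlgHom.id_apply,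
      Algebra.TensorProduct.lid_tmul]
    rw [Finset.sum_eq_single 1]
    · simp [sum_charIdempotent]
    · intro b _ hb; simp [hb]
    · simp
  counit_right := by
    classical
    change Algebra.TensorProduct.rid k k _ (Algebra.TensorProduct.map _ _ (bicharElement ω)) = 1
    simp only [bicharElement, map_sum, map_smul, Algebra.TensorProduct.map_tmul,
      Bialgebra.counitAlgHom_apply, counit_charIdempotent, AlgHom.id_apply,
      Algebra.TensorProduct.rid_tmul]
    rw [Finset.sum_comm, Finset.sum_eq_single 1]
    · simp [sum_charIdempotent]
    · intro b _ hb; simp [hb]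
    · simp

end Bicharacter

/-! ### The subgroup generated by `n` disjoint transpositions in `S_{2n}` and its bicharacter -/

section Pairs

/-- The first point of the `i`-th pair (the point `2i - 1` when counting from `1`). -/
def pairFst {n : ℕ} (i : Fin n) : Fin (2 * n) := ⟨2 * i, by omega⟩

/-- The second point of the `i`-th pair (the point `2i` when counting from `1`). -/
def pairSnd {n : ℕ} (i : Fin n) : Fin (2 * n) := ⟨2 * i + 1, by omega⟩

/-- The transposition `t_i = (2i - 1, 2i)` in `S_{2n}`. -/
def pairSwap {n : ℕ} (i : Fin n) : Equiv.Perm (Fin (2 * n)) :=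
  Equiv.swap (pairFst i) (pairSnd i)

/-- The subgroup `H` of `S_{2n}` generated by the transpositions `t_1, …, t_n`. -/
def pairSubgroup (n : ℕ) : Subgroup (Equiv.Perm (Fin (2 * n))) :=
  Subgroup.closure (Set.range pairSwap)

/-- `t_i` as an element of `H`. -/
def pairGen {n : ℕ} (i : Fin n) : pairSubgroup n :=
  ⟨pairSwap i, Subgroup.subset_closure ⟨i, rfl⟩⟩

theorem pairFst_ne_pairSnd {n : ℕ} (i j : Fin n) : pairFst i ≠ pairSnd j := by
  intro h
  have := congrArg Fin.val h
  simp only [pairFst, pairSnd] at this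
  omega

theorem pairFst_injective {n : ℕ} : Function.Injective (pairFst (n := n)) := by
  intro i j h
  have := congrArg Fin.val h
  simp only [pairFst] at this
  exact Fin.ext (by omega)

theorem pairSnd_injective {n : ℕ} : Function.Injective (pairSnd (n := n)) := by
  intro i j h
  have := congrArg Fin.val h
  simp only [pairSnd] at this
  exact Fin.ext (by omega)

theorem pairSwap_fst {n : ℕ} (i j : Fin n) :
    pairSwap j (pairFst i) = if i = j then pairSnd i else pairFst i := by
  split_ifs with h
  · subst h; exact Equiv.swap_apply_left _ _
  · exact Equiv.swap_apply_of_ne_of_ne (fun hc => h (pairFst_injective hc))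
      (pairFst_ne_pairSnd i j)

theorem pairSwap_snd {n : ℕ} (i j : Fin n) :
    pairSwap j (pairSnd i) = if i = j then pairFst i else pairSnd i := by
  split_ifs with h
  · subst h; exact Equiv.swap_apply_right _ _
  · exact Equiv.swap_apply_of_ne_of_ne (fun hc => pairFst_ne_pairSnd j i hc.symm)
      (fun hc => h (pairSnd_injective hc))

instance pairSubgroup_isMulCommutative (n : ℕ) : IsMulCommutative (pairSubgroup n) := by
  refine Subgroup.isMulCommutative_closure ?_
  rintro _ ⟨i, rfl⟩ _ ⟨j, rfl⟩
  by_cases h : i = j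
  · rw [h]
  · refine (Equiv.Perm.Disjoint.commute fun x => ?_).eq
    by_cases hx : x = pairFst i ∨ x = pairSnd i
    · right
      rcases hx with rfl | rfl
      · rw [pairSwap_fst, if_neg h]
      · rw [pairSwap_snd, if_neg h]
    · left
      rw [not_or] at hx
      exact Equiv.swap_apply_of_ne_of_ne hx.1 hx.2

/-- Elements of `H` fix or exchange the two points of each pair. -/
theorem pairSubgroup_apply {n : ℕ} (i : Fin n) (h : pairSubgroup n) :
    ((h : Equiv.Perm (Fin (2 * n))) (pairFst i) = pairFst i ∧
      (h : Equiv.Perm (Fin (2 * n))) (pairSnd i) = pairSnd i) ∨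
    ((h : Equiv.Perm (Fin (2 * n))) (pairFst i) = pairSnd i ∧
      (h : Equiv.Perm (Fin (2 * n))) (pairSnd i) = pairFst i) := by
  obtain ⟨h, hh⟩ := h
  change (h (pairFst i) = pairFst i ∧ h (pairSnd i) = pairSnd i) ∨
    (h (pairFst i) = pairSnd i ∧ h (pairSnd i) = pairFst i)
  induction hh using Subgroup.closure_induction with
  | mem x hx =>
    obtain ⟨j, rfl⟩ := hx
    rw [pairSwap_fst, pairSwap_snd]
    by_cases hij : i = j
    · right; simp [hij]
    · left; simp [hij]
  | one => left; simp
  | mul x y _ _ hx hy =>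
    simp only [Equiv.Perm.mul_apply]
    rcases hx with hx | hx <;> rcases hy with hy | hy <;> simp [hx, hy]
  | inv x _ hx =>
    simp only [Equiv.Perm.inv_eq_iff_eq]
    rcases hx with hx | hx <;> simp [hx]

theorem pairGen_sq {n : ℕ} (i : Fin n) : pairGen i * pairGen i = 1 :=
  Subtype.ext (Equiv.swap_mul_self _ _)

variable (k : Type*) [Field k]

/-- The character `a_i` of `H`: it is `-1` on the elements that exchange the two points of the
`i`-th pair, and `1` on the others; so `a_i(t_i) = -1` and `a_i(t_j) = 1` for `j ≠ i`. -/
def pairChar {n : ℕ} (i : Fin n) : pairSubgroup n →* kˣ where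
  toFun h := if (h : Equiv.Perm (Fin (2 * n))) (pairFst i) = pairFst i then 1 else -1
  map_one' := by simp
  map_mul' x y := by
    have hne := pairFst_ne_pairSnd i i
    rcases pairSubgroup_apply i x with hx | hx <;> rcases pairSubgroup_apply i y with hy | hy <;>
      simp [hx, hy, hne.symm]

theorem pairChar_pairGen {n : ℕ} (i j : Fin n) :
    pairChar k i (pairGen j) = if i = j then -1 else 1 := by
  change (if pairSwap j (pairFst i) = pairFst i then (1 : kˣ) else -1) = _
  rw [pairSwap_fst]
  by_cases h : i = j
  · simp [h, (pairFst_ne_pairSnd j j).symm]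
  · simp [h]

/-- The pairing on signs: `-1` on `(-1, -1)`, and `1` if one of the arguments is `1`. -/
noncomputable def signPairing (x y : kˣ) : kˣ :=
  open scoped Classical in if x = 1 ∨ y = 1 then 1 else -1

variable {k}

theorem char_pairGen {n : ℕ} (χ : pairSubgroup n →* kˣ) (i : Fin n) :
    χ (pairGen i) = 1 ∨ χ (pairGen i) = -1 := by
  have h : χ (pairGen i) * χ (pairGen i) = 1 := by rw [← map_mul, pairGen_sq, map_one]
  have h2 : ((χ (pairGen i) : kˣ) : k) * ((χ (pairGen i) : kˣ) : k) = 1 := by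
    rw [← Units.val_mul, h, Units.val_one]
  rcases mul_self_eq_one_iff.mp h2 with h3 | h3
  · left; exact Units.ext h3
  · right; exact Units.ext (by simpa using h3)

theorem signPairing_mul_left [CharZero k] {x x' : kˣ} (y : kˣ) (hx : x = 1 ∨ x = -1)
    (hx' : x' = 1 ∨ x' = -1) :
    signPairing k (x * x') y = signPairing k x y * signPairing k x' y := by
  have hne : (-1 : kˣ) ≠ 1 := fun h => by
    have := congrArg Units.val h
    norm_num [eq_comm, CharZero.neg_eq_self_iff] at this
  by_cases hy : y = 1
  · simp [signPairing, hy]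
  · rcases hx with rfl | rfl <;> rcases hx' with rfl | rfl <;> simp [signPairing, hy, hne]

theorem signPairing_comm (x y : kˣ) : signPairing k x y = signPairing k y x := by
  by_cases hx : x = 1 <;> by_cases hy : y = 1 <;> simp [signPairing, hx, hy]

theorem signPairing_mul_right [CharZero k] (x : kˣ) {y y' : kˣ} (hy : y = 1 ∨ y = -1)
    (hy' : y' = 1 ∨ y' = -1) :
    signPairing k x (y * y') = signPairing k x y * signPairing k x y' := by
  rw [signPairing_comm, signPairing_mul_left x hy hy', signPairing_comm y, signPairing_comm y']

/-- The product over `i < j` of the sign pairings of `χ(t_i)` and `ψ(t_j)`. -/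
noncomputable def pairForm {n : ℕ} (χ ψ : pairSubgroup n →* kˣ) : kˣ :=
  ∏ i : Fin n, ∏ j : Fin n,
    if i < j then signPairing k (χ (pairGen i)) (ψ (pairGen j)) else 1

theorem pairForm_mul_left [CharZero k] {n : ℕ} (χ χ' ψ : pairSubgroup n →* kˣ) :
    pairForm (χ * χ') ψ = pairForm χ ψ * pairForm χ' ψ := by
  simp only [pairForm, ← Finset.prod_mul_distrib]
  refine Finset.prod_congr rfl fun i _ => Finset.prod_congr rfl fun j _ => ?_
  split_ifs
  · exact signPairing_mul_left _ (char_pairGen χ i) (char_pairGen χ' i)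
  · simp

theorem pairForm_mul_right [CharZero k] {n : ℕ} (χ ψ ψ' : pairSubgroup n →* kˣ) :
    pairForm χ (ψ * ψ') = pairForm χ ψ * pairForm χ ψ' := by
  simp only [pairForm, ← Finset.prod_mul_distrib]
  refine Finset.prod_congr rfl fun i _ => Finset.prod_congr rfl fun j _ => ?_
  split_ifs
  · exact signPairing_mul_right _ (char_pairGen ψ j) (char_pairGen ψ' j)
  · simp

variable (k)

/-- The bicharacter `ω` on the dual group of `H`. It is the one with `ω(a_i, a_j) = -1` for
`i < j` and `ω(a_i, a_j) = 1` for `i ≥ j`, see `pairBicharacter_pairChar` and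
`eq_pairBicharacter`. -/
noncomputable def pairBicharacter [CharZero k] (n : ℕ) :
    (pairSubgroup n →* kˣ) →* (pairSubgroup n →* kˣ) →* kˣ :=
  MonoidHom.mk'
    (fun χ => MonoidHom.mk' (fun ψ => pairForm χ ψ) (pairForm_mul_right χ))
    (fun χ χ' => MonoidHom.ext (pairForm_mul_left χ χ'))

theorem pairBicharacter_pairChar [CharZero k] {n : ℕ} (i j : Fin n) :
    pairBicharacter k n (pairChar k i) (pairChar k j) = if i < j then -1 else 1 := by
  have hne : (-1 : kˣ) ≠ 1 := fun h => by
    have := congrArg Units.val h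
    norm_num [eq_comm, CharZero.neg_eq_self_iff] at this
  have hs : ∀ a b : Fin n, signPairing k (pairChar k i (pairGen a)) (pairChar k j (pairGen b)) =
      if i = a ∧ j = b then -1 else 1 := by
    intro a b
    rw [pairChar_pairGen, pairChar_pairGen]
    by_cases h1 : i = a <;> by_cases h2 : j = b <;> simp [signPairing, h1, h2, hne]
  change (∏ a : Fin n, ∏ b : Fin n,
    if a < b then signPairing k (pairChar k i (pairGen a)) (pairChar k j (pairGen b)) else 1) = _
  simp only [hs]
  rw [Finset.prod_eq_single i, Finset.prod_eq_single j]
  · simp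
  · intro b _ hb; simp [hb.symm]
  · simp
  · intro a _ ha; simp [ha.symm]
  · simp

theorem closure_pairChar (n : ℕ) :
    Subgroup.closure (Set.range (pairChar k (n := n))) = ⊤ := by
  classical
  rw [eq_top_iff]
  intro χ _
  have key : χ = ∏ i : Fin n, if χ (pairGen i) = 1 then 1 else pairChar k i := by
    have hgen : ∀ j : Fin n, χ (pairGen j) =
        (∏ i : Fin n, if χ (pairGen i) = 1 then 1 else pairChar k i) (pairGen j) := by
      intro j
      rw [MonoidHom.finsetProd_apply, Finset.prod_eq_single j]
      · rcases char_pairGen χ j with h | h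
        · simp [h]
        · by_cases h1 : χ (pairGen j) = 1
          · simp [h1]
          · rw [if_neg h1, pairChar_pairGen, if_pos rfl, h]
      · intro i _ hij
        split_ifs
        · rfl
        · rw [pairChar_pairGen, if_neg hij]
      · simp
    refine MonoidHom.ext fun ⟨h, hh⟩ => ?_
    induction hh using Subgroup.closure_induction with
    | mem x hx => obtain ⟨j, rfl⟩ := hx; exact hgen j
    | one => exact (map_one χ).trans (map_one _).symm
    | mul x y hx hy ihx ihy =>
      exact (map_mul χ ⟨x, hx⟩ ⟨y, hy⟩).trans
        ((congrArg₂ (· * ·) ihx ihy).trans (map_mul _ (⟨x, hx⟩ : pairSubgroup n) ⟨y, hy⟩).symm)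
    | inv x hx ihx =>
      exact (map_inv χ ⟨x, hx⟩).trans
        ((congrArg (·⁻¹) ihx).trans (map_inv _ (⟨x, hx⟩ : pairSubgroup n)).symm)
  rw [key]
  refine Subgroup.prod_mem _ fun i _ => ?_
  split_ifs
  · exact one_mem _
  · exact Subgroup.subset_closure ⟨i, rfl⟩

theorem eq_pairBicharacter [CharZero k] {n : ℕ}
    (ω : (pairSubgroup n →* kˣ) →* (pairSubgroup n →* kˣ) →* kˣ)
    (hω : ∀ i j : Fin n, ω (pairChar k i) (pairChar k j) = if i < j then -1 else 1) :
    ω = pairBicharacter k n := by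
  refine MonoidHom.eq_of_eqOn_dense (closure_pairChar k n) ?_
  rintro _ ⟨i, rfl⟩
  refine MonoidHom.eq_of_eqOn_dense (closure_pairChar k n) ?_
  rintro _ ⟨j, rfl⟩
  rw [hω, pairBicharacter_pairChar]

end Pairs

/-! ### Slices of coproducts, and integrals of Hopf subalgebras -/

section HopfSubalgebra

open Coalgebra HopfAlgebra

variable {k A : Type*} [Field k] [Ring A] [HopfAlgebra k A]

/-! Let `A` be the group algebra and `K` a normal Hopf subalgebra of `A^J`. The plan is to replace
`K` by its normalized integral `e` and to show that the twist does not affect what `e` can be. Since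
`v` is fixed by the antipode, `A^J` is involutory; so, in characteristic zero, a trace formula
produces an `e` in `K` with `ε(e) = 1` and `y e = ε(y) e` on `K`
(`IsHopfSubalgebra.exists_integral`). Normality of `K` makes `e` central in `A`, and then `Δ^J(e)(e
⊗ 1) = e ⊗ e` says the same about the untwisted `Δ`, because `e ⊗ 1` and `e ⊗ e` commute with `J`
(`HopfTwist.exists_central_integral`). In a group algebra this forces `e` to be a nonzero multiple
of the sum of a normal subgroup `N` (`exists_normal_coeff_eq`). For `2n ≥ 6` only the trivial group,
the alternating group and the whole group can occur as `N`.

If `N` is trivial, then `e = 1` and every `y` in `K` equals `ε(y) 1`.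

If `N` is everything, the slices of `Δ^J(e)` in its first leg give all elements `e_α g e_γ` up to
nonzero scalars; these span `A`, so `K = A` (`single_mem_of_coeff_const`).

The alternating case is excluded (`commute_of_coeff_ker`). There the sign `σ` agrees with `ε` on
`K`, so slicing `Δ^J(x)` by `σ` on either leg returns `x`. This exhibits the twist of `x` by `σ` as
the conjugate of `x` by `∑ ω(α, σ) e_α` and also by `∑ ω(σ, α) e_α`. For even `n` these two elements
differ by the factor `w = t_1 ⋯ t_n` (`pairBicharacter_apply_signChar`), so `w` centralizes `K`. On
the other hand, the slices of `Δ^J(e)`, compressed by `e_α` and `e_γ`, still recover every `e_α g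
e_γ` up to a nonzero scalar. Hence `w` would commute with every `g`, but `w` is not central in the
symmetric group. -/

/-- The linear map `a ⊗ b ↦ f(b) a`. -/
noncomputable def sliceRight (f : A →ₗ[k] k) : A ⊗[k] A →ₗ[k] A :=
  (TensorProduct.rid k A).toLinearMap ∘ₗ f.lTensor A

/-- The linear map `a ⊗ b ↦ f(a) b`. -/
noncomputable def sliceLeft (f : A →ₗ[k] k) : A ⊗[k] A →ₗ[k] A :=
  (TensorProduct.lid k A).toLinearMap ∘ₗ f.rTensor A

@[simp]
theorem sliceRight_tmul (f : A →ₗ[k] k) (a b : A) : sliceRight f (a ⊗ₜ[k] b) = f b • a := by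
  simp [sliceRight]

@[simp]
theorem sliceLeft_tmul (f : A →ₗ[k] k) (a b : A) : sliceLeft f (a ⊗ₜ[k] b) = f a • b := by
  simp [sliceLeft]

theorem sliceRight_counit_comul (x : A) : sliceRight (counit (R := k)) (comul (R := k) x) = x := by
  rw [sliceRight, LinearMap.comp_apply, lTensor_counit_comul]
  simp

theorem sliceLeft_counit_comul (x : A) : sliceLeft (counit (R := k)) (comul (R := k) x) = x := by
  rw [sliceLeft, LinearMap.comp_apply, rTensor_counit_comul]
  simp

theorem sliceRight_tmul_mul (f : A →ₗ[k] k) (z w : A) (X : A ⊗[k] A) :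
    sliceRight f ((z ⊗ₜ[k] w) * X) = z * sliceRight (f ∘ₗ LinearMap.mulLeft k w) X := by
  induction X with
  | zero => simp
  | add X Y hX hY => simp only [mul_add, map_add, hX, hY]
  | tmul a b => simp

/-- In Sweedler notation, with `X = a ⊗ b`: `∑ S(y₁) y₂ a f(y₃ b)` collapses to `a f(y b)` by
coassociativity and the antipode axiom. With `X = Δ(x)` this writes `x ↦ ∑ x₁ f(y x₂)` as a sum of
products of operators to which cyclicity of the trace applies. -/
theorem sum_antipode_mul_sliceRight (f : A →ₗ[k] k) (y : A) (X : A ⊗[k] A) :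
    LinearMap.mul' k A (TensorProduct.map (antipode k)
      (sliceRight f ∘ₗ LinearMap.mulRight k X ∘ₗ comul) (comul (R := k) y)) =
    sliceRight (f ∘ₗ LinearMap.mulLeft k y) X := by
  have h1 : ∀ Z : A ⊗[k] A, TensorProduct.map (antipode k)
      (sliceRight f ∘ₗ LinearMap.mulRight k X ∘ₗ comul) Z =
      TensorProduct.map (antipode k) (sliceRight f ∘ₗ LinearMap.mulRight k X)
        ((comul (R := k)).lTensor A Z) := fun Z => by
    induction Z with
    | zero => simp
    | add Z W hZ hW => simp only [map_add, hZ, hW]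
    | tmul a b => simp
  have h2 : ∀ (Z : A ⊗[k] A) (w : A), LinearMap.mul' k A
      (TensorProduct.map (antipode k) (sliceRight f ∘ₗ LinearMap.mulRight k X)
        (TensorProduct.assoc k A A A (Z ⊗ₜ[k] w))) =
      LinearMap.mul' k A ((antipode k).rTensor A Z) *
        sliceRight (f ∘ₗ LinearMap.mulLeft k w) X := fun Z w => by
    induction Z with
    | zero => simp
    | add Z W hZ hW => simp only [TensorProduct.add_tmul, map_add, hZ, hW, add_mul]
    | tmul a b => simp [sliceRight_tmul_mul, mul_assoc]
  have h3 : ∀ Z : A ⊗[k] A, LinearMap.mul' k A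
      (TensorProduct.map (antipode k) (sliceRight f ∘ₗ LinearMap.mulRight k X)
        (TensorProduct.assoc k A A A ((comul (R := k)).rTensor A Z))) =
      sliceRight (f ∘ₗ LinearMap.mulLeft k (sliceLeft (counit (R := k)) Z)) X := fun Z => by
    have hlin : ∀ (u : A), sliceRight (f ∘ₗ LinearMap.mulLeft k u) X =
        sliceRight f (((1 : A) ⊗ₜ[k] u) * X) := fun u => by
      rw [sliceRight_tmul_mul, one_mul]
    induction Z with
    | zero => simp only [hlin]; simp
    | add Z W hZ hW =>
      simp only [map_add, hZ, hW]
      simp only [hlin, TensorProduct.tmul_add, add_mul, map_add]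
    | tmul a b =>
      rw [LinearMap.rTensor_tmul, h2, mul_antipode_rTensor_comul_apply]
      simp [hlin, Algebra.algebraMap_eq_smul_one]
  rw [h1, ← coassoc_apply, h3, sliceLeft_counit_comul]

variable {K : Subalgebra k A}

theorem sliceRight_mem (f : A →ₗ[k] k) {X : A ⊗[k] A}
    (hX : X ∈ LinearMap.range (TensorProduct.map K.val.toLinearMap K.val.toLinearMap)) :
    sliceRight f X ∈ K := by
  obtain ⟨t, rfl⟩ := hX
  induction t with
  | zero => simp
  | add s t hs ht => rw [map_add, map_add]; exact add_mem hs ht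
  | tmul a b => simpa using K.smul_mem a.2 _

theorem sliceLeft_mem (f : A →ₗ[k] k) {X : A ⊗[k] A}
    (hX : X ∈ LinearMap.range (TensorProduct.map K.val.toLinearMap K.val.toLinearMap)) :
    sliceLeft f X ∈ K := by
  obtain ⟨t, rfl⟩ := hX
  induction t with
  | zero => simp
  | add s t hs ht => rw [map_add, map_add]; exact add_mem hs ht
  | tmul a b => simpa using K.smul_mem b.2 _

theorem sliceRight_congr {f g : A →ₗ[k] k} (hfg : ∀ x ∈ K, f x = g x) {X : A ⊗[k] A}
    (hX : X ∈ LinearMap.range (TensorProduct.map K.val.toLinearMap K.val.toLinearMap)) :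
    sliceRight f X = sliceRight g X := by
  obtain ⟨t, rfl⟩ := hX
  induction t with
  | zero => simp
  | add s t hs ht => simp only [map_add, hs, ht]
  | tmul a b => simp [hfg]

theorem sliceLeft_congr {f g : A →ₗ[k] k} (hfg : ∀ x ∈ K, f x = g x) {X : A ⊗[k] A}
    (hX : X ∈ LinearMap.range (TensorProduct.map K.val.toLinearMap K.val.toLinearMap)) :
    sliceLeft f X = sliceLeft g X := by
  obtain ⟨t, rfl⟩ := hX
  induction t with
  | zero => simp
  | add s t hs ht => simp only [map_add, hs, ht]
  | tmul a b => simp [hfg]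

/-- The operator `x ↦ ∑ x₁ f(x₂)` on a Hopf subalgebra. -/
noncomputable def IsHopfSubalgebra.hit (hK : IsHopfSubalgebra K) (f : A →ₗ[k] k) : K →ₗ[k] K :=
  (sliceRight f ∘ₗ comul ∘ₗ K.val.toLinearMap).codRestrict (Subalgebra.toSubmodule K)
    fun x => sliceRight_mem f (hK.comul_mem x x.2)

theorem IsHopfSubalgebra.coe_hit (hK : IsHopfSubalgebra K) (f : A →ₗ[k] k) (x : K) :
    (hK.hit f x : A) = sliceRight f (comul (R := k) (x : A)) := rfl

/-- This is `∑ y₂ S(y₁) = ε(y)`: apply `S` to `∑ y₁ S(y₂) = ε(y)` and use `S² = id`. -/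
theorem mul_antipode_swap (hS : ∀ x : A, antipode k (antipode k x) = x) (y : A) (X : A ⊗[k] A)
    (hX : X = comul (R := k) y) :
    LinearMap.mul' k A (TensorProduct.comm k A A ((antipode k).rTensor A X)) =
      counit (R := k) y • (1 : A) := by
  have h1 : ∀ X : A ⊗[k] A, LinearMap.mul' k A
      (TensorProduct.comm k A A ((antipode k).rTensor A X)) =
      antipode k (LinearMap.mul' k A ((antipode k).lTensor A X)) := fun X => by
    induction X with
    | zero => simp
    | add X Y hX hY => simp only [map_add, hX, hY]
    | tmul a b => simp [antipode_mul_antidistrib, hS]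
  rw [h1, hX, mul_antipode_lTensor_comul_apply, Algebra.algebraMap_eq_smul_one, map_smul,
    antipode_one]

/-- The operator on the left is `∑ L(S(y₁)) ∘ hit f ∘ L(y₂)`, with `L` for left multiplication.
Moving the first factor to the end under the trace leaves `∑ L(y₂ S(y₁)) = ε(y)`. This is the
invariance that makes the trace form an integral. -/
theorem IsHopfSubalgebra.trace_hit_comp_mulLeft [FiniteDimensional k A]
    (hS : ∀ x : A, antipode k (antipode k x) = x)
    (hK : IsHopfSubalgebra K) (f : A →ₗ[k] k) {y : A} (hy : y ∈ K) :
    LinearMap.trace k K (hK.hit (f ∘ₗ LinearMap.mulLeft k y)) =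
      counit (R := k) y * LinearMap.trace k K (hK.hit f) := by
  obtain ⟨t, ht⟩ := hK.comul_mem y hy
  obtain ⟨s, rfl⟩ := TensorProduct.exists_finset t
  have ht' : comul (R := k) y = ∑ i ∈ s, (i.1 : A) ⊗ₜ[k] (i.2 : A) := by
    rw [← ht]; simp
  have hop : hK.hit (f ∘ₗ LinearMap.mulLeft k y) =
      ∑ i ∈ s, LinearMap.mulLeft k (⟨antipode k i.1, hK.antipode_mem _ i.1.2⟩ : K) *
        (hK.hit f * LinearMap.mulLeft k i.2) := by
    ext x
    rw [hK.coe_hit, ← sum_antipode_mul_sliceRight, ht']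
    simp [LinearMap.sum_apply, hK.coe_hit]
  have hid : ∑ i ∈ s, LinearMap.mulLeft k i.2 *
      LinearMap.mulLeft k (⟨antipode k i.1, hK.antipode_mem _ i.1.2⟩ : K) =
      counit (R := k) y • 1 := by
    have h := mul_antipode_swap hS y _ ht'.symm
    simp only [map_sum, LinearMap.rTensor_tmul, TensorProduct.comm_tmul,
      LinearMap.mul'_apply] at h
    ext x
    simp only [LinearMap.sum_apply, Module.End.mul_apply, LinearMap.mulLeft_apply,
      LinearMap.smul_apply, Module.End.one_apply, AddSubmonoidClass.coe_finsetSum,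
      Subalgebra.coe_mul, Subalgebra.coe_smul]
    simp only [← mul_assoc, ← Finset.sum_mul]
    rw [h, smul_mul_assoc, one_mul]
  rw [hop, map_sum]
  have : ∀ i ∈ s, LinearMap.trace k K
      (LinearMap.mulLeft k (⟨antipode k i.1, hK.antipode_mem _ i.1.2⟩ : K) *
        (hK.hit f * LinearMap.mulLeft k i.2)) = LinearMap.trace k K (hK.hit f *
        (LinearMap.mulLeft k i.2 *
          LinearMap.mulLeft k (⟨antipode k i.1, hK.antipode_mem _ i.1.2⟩ : K))) := fun i _ => by
    rw [LinearMap.trace_mul_comm, mul_assoc]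
  rw [Finset.sum_congr rfl this, ← map_sum, ← Finset.mul_sum, hid]
  simp

/-- A Hopf subalgebra of a finite dimensional involutory Hopf algebra in characteristic zero has
a normalized left integral. -/
theorem IsHopfSubalgebra.exists_integral [CharZero k] [FiniteDimensional k A]
    (hS : ∀ x : A, antipode k (antipode k x) = x) (hK : IsHopfSubalgebra K) :
    ∃ e ∈ K, counit (R := k) e = 1 ∧ ∀ y ∈ K, y * e = counit (R := k) y • e := by
  -- The integral is the element `Λ` representing `f ↦ tr(x ↦ ∑ x₁ f(x₂))`, which exists because `A`
  -- is finite dimensional.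
  let τ : Module.Dual k (Module.Dual k A) :=
    { toFun := fun f => LinearMap.trace k K (hK.hit f)
      map_add' := fun f g => by
        rw [← map_add]
        congr 1
        ext x
        rw [LinearMap.add_apply, Subalgebra.coe_add]
        simp only [hK.coe_hit, sliceRight, LinearMap.lTensor_add]
        simp
      map_smul' := fun r f => by
        rw [RingHom.id_apply, ← map_smul]
        congr 1
        ext x
        rw [LinearMap.smul_apply, Subalgebra.coe_smul]
        simp only [hK.coe_hit, sliceRight, LinearMap.lTensor_smul]
        simp }
  obtain ⟨Λ, hΛ⟩ := (Module.evalEquiv k A).surjective τ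
  have hf : ∀ f : A →ₗ[k] k, f Λ = LinearMap.trace k K (hK.hit f) := fun f =>
    LinearMap.congr_fun hΛ f
  -- A form vanishing on `K` gives the zero operator, so it kills `Λ`; hence `Λ` lies in the double
  -- annihilator of `K`.
  have hmem : Λ ∈ K := by
    have := (Subspace.forall_mem_dualAnnihilator_apply_eq_zero_iff
      (Subalgebra.toSubmodule K) Λ).1
    refine this fun f hfK => ?_
    rw [Submodule.mem_dualAnnihilator] at hfK
    have h0 : hK.hit f = 0 := by
      ext x
      rw [hK.coe_hit, sliceRight_congr (g := 0) hfK (hK.comul_mem x x.2)]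
      simp [sliceRight]
    exact (hf f).trans (by rw [h0, map_zero])
  -- For `f = ε` the operator is the identity; characteristic zero makes its trace invertible.
  have hone : counit (R := k) Λ = (Module.finrank k K : k) := by
    rw [hf, ← LinearMap.trace_one]
    congr 1
    ext x
    rw [hK.coe_hit, sliceRight_counit_comul]
    rfl
  have hint : ∀ y ∈ K, y * Λ = counit (R := k) y • Λ := fun y hy => by
    rw [← sub_eq_zero, ← Module.forall_dual_apply_eq_zero_iff k]
    intro f
    have h1 := hf (f ∘ₗ LinearMap.mulLeft k y)
    rw [hK.trace_hit_comp_mulLeft hS f hy, ← hf] at h1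
    rw [map_sub, map_smul, sub_eq_zero]
    exact h1
  by_cases hA : Nontrivial A
  · have hdim : (Module.finrank k K : k) ≠ 0 := Nat.cast_ne_zero.mpr Module.finrank_pos.ne'
    refine ⟨(Module.finrank k K : k)⁻¹ • Λ, K.smul_mem hmem _, ?_, fun y hy => ?_⟩
    · rw [map_smul, hone, smul_eq_mul, inv_mul_cancel₀ hdim]
    · rw [mul_smul_comm, hint y hy, smul_comm]
  · rw [not_nontrivial_iff_subsingleton] at hA
    have h : counit (R := k) (1 : A) = 1 := Bialgebra.counit_one
    rw [Subsingleton.elim (1 : A) 0, map_zero] at h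
    exact absurd h zero_ne_one

/-! ### Adjoint stability and centrality of the integral -/

/-- This is `∑ ad(h₁)(x) h₂ = h x`, from `∑ h₁ x S(h₂) h₃`. It moves `h` past `x` at the cost of
adjoint terms, which stay in `K` when `x` does. -/
theorem leftAdjoint_mul_comul (h x : A) :
    LinearMap.mul' k A (TensorProduct.map
      (LinearMap.mul' k A ∘ₗ TensorProduct.map (LinearMap.mulRight k x) (antipode k) ∘ₗ comul)
      LinearMap.id (comul (R := k) h)) = h * x := by
  have h1 : ∀ Z : A ⊗[k] A, TensorProduct.map
      (LinearMap.mul' k A ∘ₗ TensorProduct.map (LinearMap.mulRight k x) (antipode k) ∘ₗ comul)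
      LinearMap.id Z = TensorProduct.map
        (LinearMap.mul' k A ∘ₗ TensorProduct.map (LinearMap.mulRight k x) (antipode k))
        LinearMap.id ((comul (R := k)).rTensor A Z) := fun Z => by
    induction Z with
    | zero => simp
    | add Z W hZ hW => simp only [map_add, hZ, hW]
    | tmul a b => simp
  have h2 : ∀ (a : A) (Z : A ⊗[k] A), LinearMap.mul' k A (TensorProduct.map
        (LinearMap.mul' k A ∘ₗ TensorProduct.map (LinearMap.mulRight k x) (antipode k))
        LinearMap.id ((TensorProduct.assoc k A A A).symm (a ⊗ₜ[k] Z))) =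
      a * x * LinearMap.mul' k A ((antipode k).rTensor A Z) := fun a Z => by
    induction Z with
    | zero => simp
    | add Z W hZ hW => simp only [TensorProduct.tmul_add, map_add, hZ, hW, mul_add]
    | tmul b c => simp [mul_assoc]
  have h3 : ∀ Z : A ⊗[k] A, LinearMap.mul' k A (TensorProduct.map
        (LinearMap.mul' k A ∘ₗ TensorProduct.map (LinearMap.mulRight k x) (antipode k))
        LinearMap.id ((TensorProduct.assoc k A A A).symm ((comul (R := k)).lTensor A Z))) =
      sliceRight (counit (R := k)) Z * x := fun Z => by
    induction Z with
    | zero => simp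
    | add Z W hZ hW => simp only [map_add, hZ, hW, add_mul]
    | tmul a b =>
      rw [LinearMap.lTensor_tmul, h2, mul_antipode_rTensor_comul_apply]
      simp [Algebra.algebraMap_eq_smul_one]
  rw [h1, ← coassoc_symm_apply, h3, sliceRight_counit_comul]

theorem counit_leftAdjoint (h x : A) :
    counit (R := k) (leftAdjoint k h x) = counit (R := k) h * counit (R := k) x := by
  have h1 : ∀ Z : A ⊗[k] A, counit (R := k) (LinearMap.mul' k A
      (TensorProduct.map (LinearMap.mulRight k x) (antipode k) Z)) =
      counit (R := k) (sliceRight (counit (R := k)) Z) * counit (R := k) x := fun Z => by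
    induction Z with
    | zero => simp
    | add Z W hZ hW => simp only [map_add, hZ, hW, add_mul]
    | tmul a b => simp; ring
  rw [leftAdjoint, h1, sliceRight_counit_comul]

/-- A normal Hopf subalgebra of a finite dimensional involutory Hopf algebra in characteristic
zero has a normalized two-sided integral that is central in the whole algebra. -/
theorem IsHopfSubalgebra.exists_central_integral [CharZero k] [FiniteDimensional k A]
    (hS : ∀ x : A, antipode k (antipode k x) = x) (hK : IsHopfSubalgebra K)
    (hN : IsAdjointStable K) :
    ∃ e ∈ K, counit (R := k) e = 1 ∧ (∀ y ∈ K, y * e = counit (R := k) y • e) ∧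
      (∀ a : A, a * e = e * a) ∧
      comul (R := k) e * (e ⊗ₜ[k] (1 : A)) = e ⊗ₜ[k] e := by
  obtain ⟨e, heK, he1, hel⟩ := hK.exists_integral hS
  have hr : ∀ y ∈ K, antipode k e * y = counit (R := k) y • antipode k e := fun y hy => by
    have h := congrArg (antipode k) (hel _ (hK.antipode_mem y hy))
    rwa [antipode_mul_antidistrib, hS, map_smul, counit_antipode] at h
  -- `S(e)` is a normalized right integral of `K`, so `S(e) e` equals both `e` and `S(e)`.
  have hSe : antipode k e = e := by
    have h1 := hel _ (hK.antipode_mem e heK)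
    rw [hr e heK, counit_antipode, he1, one_smul, one_smul] at h1
    exact h1
  rw [hSe] at hr
  -- Expand `a e = ∑ ad(a₁)(e) a₂`; by stability `ad(a₁)(e)` lies in `K`, so `e` absorbs it as the
  -- scalar `ε(a₁)`.
  have heae : ∀ a : A, e * (a * e) = e * a := fun a => by
    have h1 : ∀ Z : A ⊗[k] A, e * LinearMap.mul' k A (TensorProduct.map
        (LinearMap.mul' k A ∘ₗ TensorProduct.map (LinearMap.mulRight k e) (antipode k) ∘ₗ comul)
        LinearMap.id Z) = e * sliceLeft (counit (R := k)) Z := fun Z => by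
      induction Z with
      | zero => simp
      | add Z W hZ hW => simp only [map_add, mul_add, hZ, hW]
      | tmul b c =>
        change e * (leftAdjoint k b e * c) = _
        rw [← mul_assoc, hr _ (hN b e heK), counit_leftAdjoint, he1]
        simp
    rw [← leftAdjoint_mul_comul (k := k) a e, h1, sliceLeft_counit_comul]
  -- Applying the antipode to `e S(a) e = e S(a)` gives `e a e = a e`, to be compared with `e a e =
  -- e a`.
  have hcen : ∀ a : A, a * e = e * a := fun a => by
    have h := congrArg (antipode k) (heae (antipode k a))
    simp only [antipode_mul_antidistrib, hS, hSe] at h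
    rw [← heae a, ← mul_assoc, h]
  refine ⟨e, heK, he1, hel, hcen, ?_⟩
  have h1 : ∀ X ∈ LinearMap.range (TensorProduct.map K.val.toLinearMap K.val.toLinearMap),
      X * (e ⊗ₜ[k] (1 : A)) = e ⊗ₜ[k] sliceLeft (counit (R := k)) X := by
    rintro _ ⟨t, rfl⟩
    induction t with
    | zero => simp
    | add s t hs ht => simp only [map_add, add_mul, hs, ht, TensorProduct.tmul_add]
    | tmul a b => simp [hel, TensorProduct.smul_tmul]
  rw [h1 _ (hK.comul_mem e heK), sliceLeft_counit_comul]

end HopfSubalgebra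

/-! ### Central integrals in a group algebra and normal subgroups -/

section GroupAlgebra

open MonoidAlgebra Coalgebra HopfAlgebra

attribute [local instance] Fintype.ofFinite

variable {k G : Type*} [Field k]

theorem sum_single_coeff [Finite G] (x : MonoidAlgebra k G) :
    ∑ g : G, single g (x.coeff g) = x := by
  classical
  ext h
  rw [coeff_sum, Finsupp.finsetSum_apply, Finset.sum_eq_single h]
  · simp
  · intro b _ hb; simp [coeff_single, hb]
  · simp

/-- The linear form `x ↦ x_g` on the group algebra. -/
noncomputable def coeffForm (k : Type*) {G : Type*} [Field k] (g : G) :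
    MonoidAlgebra k G →ₗ[k] k :=
  Finsupp.lapply g ∘ₗ (coeffLinearEquiv k).toLinearMap

@[simp]
theorem coeffForm_apply (g : G) (x : MonoidAlgebra k G) : coeffForm k g x = x.coeff g := rfl

theorem counit_eq_sum [Finite G] (x : MonoidAlgebra k G) :
    counit (R := k) x = ∑ g : G, x.coeff g := by
  conv_lhs => rw [← sum_single_coeff x]
  simp

variable [Group G]

theorem comul_eq_sum [Finite G] (x : MonoidAlgebra k G) :
    comul (R := k) x = ∑ g : G, x.coeff g • (single g (1 : k) ⊗ₜ[k] single g (1 : k)) := by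
  conv_lhs => rw [← sum_single_coeff x]
  rw [map_sum]
  refine Finset.sum_congr rfl fun g _ => ?_
  have : single g (x.coeff g) = x.coeff g • (single g (1 : k) : MonoidAlgebra k G) := by simp
  rw [this, map_smul]
  simp

/-- A central element `e` of counit one with `Δ(e)(e ⊗ 1) = e ⊗ e` is a multiple of the sum of the
elements of a normal subgroup. -/
theorem exists_normal_coeff_eq [Finite G] {e : MonoidAlgebra k G}
    (he1 : counit (R := k) e = 1) (hcen : ∀ a, a * e = e * a)
    (hcomul : comul (R := k) e * (e ⊗ₜ[k] (1 : MonoidAlgebra k G)) = e ⊗ₜ[k] e) :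
    ∃ N : Subgroup G, N.Normal ∧ ∃ c : k, c ≠ 0 ∧ (∀ g ∈ N, e.coeff g = c) ∧
      ∀ g ∉ N, e.coeff g = 0 := by
  classical
  -- The subgroup is the stabilizer of `e` under left translation.
  let N : Subgroup G :=
    { carrier := {g | single g (1 : k) * e = e}
      one_mem' := by
        change single (1 : G) (1 : k) * e = e
        rw [← one_def, one_mul]
      mul_mem' := fun {a b} ha hb => by
        change single (a * b) (1 : k) * e = e
        have h : (single (a * b) (1 : k) : MonoidAlgebra k G) = single a 1 * single b 1 := by
          simp [single_mul_single]
        rw [h, mul_assoc, show single b (1 : k) * e = e from hb]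
        exact ha
      inv_mem' := fun {a} ha => by
        change single a⁻¹ (1 : k) * e = e
        conv_lhs => rw [← show single a (1 : k) * e = e from ha]
        rw [← mul_assoc, single_mul_single, inv_mul_cancel, one_mul, ← one_def, one_mul] }
  have hmemN : ∀ g, g ∈ N ↔ single g (1 : k) * e = e := fun g => Iff.rfl
  have hsupp : ∀ g ∉ N, e.coeff g = 0 := fun g hg => by
    by_contra h0
    apply hg
    -- As `Δ(e) = ∑ e_h h ⊗ h`, the part of the identity with `g` in the second leg reads `e_g (g e)
    -- = e_g e`. So a nonzero coefficient at `g` puts `g` in the stabilizer.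
    have h1 := congrArg (sliceRight (coeffForm k g)) hcomul
    rw [comul_eq_sum, Finset.sum_mul, map_sum, Finset.sum_eq_single g] at h1
    · rw [smul_mul_assoc, Algebra.TensorProduct.tmul_mul_tmul, mul_one, map_smul, sliceRight_tmul,
        sliceRight_tmul, coeffForm_apply, coeffForm_apply, coeff_single, Finsupp.single_eq_same,
        one_smul] at h1
      exact smul_right_injective _ h0 h1
    · intro b _ hb
      rw [smul_mul_assoc, Algebra.TensorProduct.tmul_mul_tmul, map_smul, sliceRight_tmul]
      simp [coeff_single, hb]
    · simp
  have hconst : ∀ g ∈ N, e.coeff g = e.coeff 1 := fun g hg => by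
    rw [hmemN] at hg
    conv_lhs => rw [← hg]
    rw [coeff_single_mul_apply]
    simp
  refine ⟨N, ⟨fun g hg h => ?_⟩, e.coeff 1, fun h0 => ?_, hconst, hsupp⟩
  · rw [hmemN] at hg ⊢
    have h1 : (single (h * g * h⁻¹) (1 : k) : MonoidAlgebra k G) =
        single h 1 * (single g 1 * single h⁻¹ 1) := by
      simp [single_mul_single, mul_assoc]
    rw [h1, mul_assoc, mul_assoc, hcen, ← mul_assoc (single g 1), hg, ← hcen, ← mul_assoc,
      single_mul_single, mul_inv_cancel, one_mul, ← one_def, one_mul]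
  · have : ∀ g, e.coeff g = 0 := fun g => by
      by_cases hg : g ∈ N
      · rw [hconst g hg, h0]
      · exact hsupp g hg
    rw [counit_eq_sum, Finset.sum_eq_zero fun g _ => this g] at he1
    exact zero_ne_one he1

/-! ### Coefficientwise products and twists by linear characters -/

/-- The coefficientwise product of two elements of a group algebra. -/
noncomputable def coeffMul [Finite G] (x y : MonoidAlgebra k G) : MonoidAlgebra k G :=
  ∑ g : G, single g (x.coeff g * y.coeff g)

theorem coeffMul_of_const [Finite G] {x : MonoidAlgebra k G} {c : k}
    (hx : ∀ g, x.coeff g = c) (y : MonoidAlgebra k G) : coeffMul x y = c • y := by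
  conv_rhs => rw [← sum_single_coeff y]
  rw [coeffMul, Finset.smul_sum]
  simp [hx]

theorem coeff_antipode (x : MonoidAlgebra k G) (g : G) :
    (antipode k x).coeff g = x.coeff g⁻¹ := by
  classical
  induction x using MonoidAlgebra.induction_linear with
  | zero => simp
  | add x y hx hy => simp [hx, hy]
  | single h r =>
    rw [antipode_single, coeff_single, coeff_single, Finsupp.single_apply, Finsupp.single_apply]
    simp [CommSemiring.antipode_eq_id, inv_eq_iff_eq_inv]

theorem coeff_one_mul_comm (x y : MonoidAlgebra k G) :
    (x * y).coeff 1 = (y * x).coeff 1 := by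
  classical
  induction x using MonoidAlgebra.induction_linear with
  | zero => simp
  | add x y hx hy => simp [add_mul, mul_add, hx, hy]
  | single h r => rw [coeff_single_mul_apply, coeff_mul_single_apply]; simp [mul_comm]

/-- The coefficient of `a g b` at `1` is that of `b a` at `g⁻¹`, by the trace property. Thus slices
of a coproduct of the group algebra are coefficientwise products. -/
theorem sliceLeft_mul_comul_mul [Finite G] (a b x : MonoidAlgebra k G) :
    sliceLeft (coeffForm k (1 : G)) ((a ⊗ₜ[k] (1 : MonoidAlgebra k G)) * comul (R := k) x *
      (b ⊗ₜ[k] (1 : MonoidAlgebra k G))) = coeffMul x (antipode k (b * a)) := by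
  rw [comul_eq_sum, Finset.mul_sum, Finset.sum_mul, map_sum, coeffMul]
  refine Finset.sum_congr rfl fun g _ => ?_
  rw [mul_smul_comm, smul_mul_assoc, Algebra.TensorProduct.tmul_mul_tmul,
    Algebra.TensorProduct.tmul_mul_tmul, map_smul, sliceLeft_tmul, coeffForm_apply,
    coeff_antipode, one_mul, mul_one, coeff_one_mul_comm, ← mul_assoc, coeff_mul_single_apply]
  simp

/-- The automorphism `g ↦ σ(g) g` of the group algebra attached to a linear character `σ`. -/
noncomputable def charTwist (σ : G →* kˣ) : MonoidAlgebra k G →ₐ[k] MonoidAlgebra k G :=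
  MonoidAlgebra.lift k _ G
    { toFun := fun g => single g ((σ g : kˣ) : k)
      map_one' := by simp [one_def]
      map_mul' := fun g h => by simp [single_mul_single] }

@[simp]
theorem charTwist_single (σ : G →* kˣ) (g : G) (r : k) :
    charTwist σ (single g r) = single g (r * ((σ g : kˣ) : k)) := by
  simp [charTwist]

theorem coeff_charTwist (σ : G →* kˣ) (x : MonoidAlgebra k G) (g : G) :
    (charTwist σ x).coeff g = x.coeff g * ((σ g : kˣ) : k) := by
  classical
  induction x using MonoidAlgebra.induction_linear with
  | zero => simp
  | add x y hx hy => simp [hx, hy, add_mul]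
  | single h r =>
    rw [charTwist_single, coeff_single, coeff_single, Finsupp.single_apply, Finsupp.single_apply]
    split_ifs with hh
    · rw [hh]
    · simp

/-- The linear form on the group algebra attached to a linear character `σ`. -/
noncomputable def charForm (σ : G →* kˣ) : MonoidAlgebra k G →ₐ[k] k :=
  (Bialgebra.counitAlgHom k (MonoidAlgebra k G)).comp (charTwist σ)

@[simp]
theorem charForm_single (σ : G →* kˣ) (g : G) (r : k) :
    charForm σ (single g r) = r * ((σ g : kˣ) : k) := by
  simp [charForm]

theorem sliceRight_charForm_comul (σ : G →* kˣ) (x : MonoidAlgebra k G) :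
    sliceRight (charForm σ).toLinearMap (comul (R := k) x) = charTwist σ x := by
  induction x using MonoidAlgebra.induction_linear with
  | zero => simp
  | add x y hx hy => simp only [map_add, hx, hy]
  | single h r => simp [mul_comm]

theorem sliceLeft_charForm_comul (σ : G →* kˣ) (x : MonoidAlgebra k G) :
    sliceLeft (charForm σ).toLinearMap (comul (R := k) x) = charTwist σ x := by
  induction x using MonoidAlgebra.induction_linear with
  | zero => simp
  | add x y hx hy => simp only [map_add, hx, hy]
  | single h r => simp [mul_comm]

theorem sliceRight_algHom_mul {A : Type*} [Ring A] [HopfAlgebra k A] (f : A →ₐ[k] k)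
    (X Y : A ⊗[k] A) :
    sliceRight f.toLinearMap (X * Y) = sliceRight f.toLinearMap X * sliceRight f.toLinearMap Y := by
  induction X with
  | zero => simp
  | add X Z hX hZ => simp only [map_add, add_mul, hX, hZ]
  | tmul a b =>
    induction Y with
    | zero => simp
    | add Y Z hY hZ => simp only [map_add, mul_add, hY, hZ]
    | tmul c d => simp [smul_smul, mul_comm]

theorem sliceLeft_algHom_mul {A : Type*} [Ring A] [HopfAlgebra k A] (f : A →ₐ[k] k)
    (X Y : A ⊗[k] A) :
    sliceLeft f.toLinearMap (X * Y) = sliceLeft f.toLinearMap X * sliceLeft f.toLinearMap Y := by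
  induction X with
  | zero => simp
  | add X Z hX hZ => simp only [map_add, add_mul, hX, hZ]
  | tmul a b =>
    induction Y with
    | zero => simp
    | add Y Z hY hZ => simp only [map_add, mul_add, hY, hZ]
    | tmul c d => simp [smul_smul, mul_comm]

/-- The indicator function of the kernel of a quadratic character is `(1 + σ) / 2`. -/
theorem coeffMul_of_ker [Finite G] [CharZero k] (σ : G →* kˣ) (hσ : ∀ g, σ g = 1 ∨ σ g = -1)
    {x : MonoidAlgebra k G} {c : k} (hx : ∀ g ∈ σ.ker, x.coeff g = c)
    (hx' : ∀ g ∉ σ.ker, x.coeff g = 0) (y : MonoidAlgebra k G) :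
    coeffMul x y = (c / 2) • (y + charTwist σ y) := by
  rw [← sum_single_coeff (y + charTwist σ y), coeffMul, Finset.smul_sum]
  refine Finset.sum_congr rfl fun g _ => ?_
  rw [smul_single, coeff_add, Finsupp.add_apply, coeff_charTwist, smul_eq_mul]
  congr 1
  by_cases hg : g ∈ σ.ker
  · rw [hx g hg, MonoidHom.mem_ker.mp hg, Units.val_one]; ring
  · rw [hx' g hg, (hσ g).resolve_left hg]; simp

/-! ### The idempotents `e_χ` and slices of the twist -/

variable {H : Subgroup G} [Finite H]

theorem charTwist_charIdempotent (σ : G →* kˣ) (χ : H →* kˣ) :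
    charTwist σ (charIdempotent χ : MonoidAlgebra k G) =
      charIdempotent (χ * (σ.comp H.subtype)⁻¹) := by
  rw [charIdempotent, charIdempotent, map_smul, map_sum]
  simp

theorem antipode_charIdempotent (hH : ∀ h : H, h * h = 1) (χ : H →* kˣ) :
    antipode k (charIdempotent χ : MonoidAlgebra k G) = charIdempotent χ := by
  have hinv : ∀ h : H, (h : G)⁻¹ = h := fun h => by
    rw [← Subgroup.coe_inv, inv_eq_of_mul_eq_one_left (hH h)]
  rw [charIdempotent, map_smul, map_sum]
  simp [hinv, CommSemiring.antipode_eq_id]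

/-- The element `∑ f(α) e_α`. -/
noncomputable def charSum (f : (H →* kˣ) → k) : MonoidAlgebra k G :=
  ∑ α : H →* kˣ, f α • charIdempotent α

variable [CharZero k]

theorem charSum_mul_charIdempotent (f : (H →* kˣ) → k) (α : H →* kˣ) :
    (charSum f * charIdempotent α : MonoidAlgebra k G) = f α • charIdempotent α := by
  classical
  rw [charSum, Finset.sum_mul, Finset.sum_eq_single α]
  · simp [charIdempotent_mul]
  · intro b _ hb; simp [charIdempotent_mul, hb]
  · simp

theorem charIdempotent_mul_charSum (f : (H →* kˣ) → k) (α : H →* kˣ) :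
    (charIdempotent α * charSum f : MonoidAlgebra k G) = f α • charIdempotent α := by
  classical
  rw [charSum, Finset.mul_sum, Finset.sum_eq_single α]
  · simp [charIdempotent_mul]
  · intro b _ hb; simp [charIdempotent_mul, hb.symm]
  · simp

/-- Orthogonality of the idempotents keeps only the row `α` of the double sum; so a cut by `e_α` in
the first leg turns the twist into a pure tensor. -/
theorem charIdempotent_tmul_one_mul_bicharElement (ω : (H →* kˣ) →* (H →* kˣ) →* kˣ)
    (α : H →* kˣ) :
    ((charIdempotent α ⊗ₜ[k] 1) * bicharElement ω : MonoidAlgebra k G ⊗[k] MonoidAlgebra k G) =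
      charIdempotent α ⊗ₜ[k] charSum fun β => ((ω α β : kˣ) : k) := by
  classical
  rw [bicharElement, Finset.mul_sum, Finset.sum_eq_single α, charSum, Finset.mul_sum,
    TensorProduct.tmul_sum]
  · simp [mul_smul_comm, Algebra.TensorProduct.tmul_mul_tmul, charIdempotent_mul]
  · intro b _ hb
    simp [Finset.mul_sum, mul_smul_comm, Algebra.TensorProduct.tmul_mul_tmul,
      charIdempotent_mul, hb.symm]
  · simp

theorem bicharElement_mul_charIdempotent_tmul_one (ω : (H →* kˣ) →* (H →* kˣ) →* kˣ)
    (α : H →* kˣ) :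
    (bicharElement ω * (charIdempotent α ⊗ₜ[k] 1) : MonoidAlgebra k G ⊗[k] MonoidAlgebra k G) =
      charIdempotent α ⊗ₜ[k] charSum fun β => ((ω α β : kˣ) : k) := by
  classical
  rw [bicharElement, Finset.sum_mul, Finset.sum_eq_single α, charSum, Finset.sum_mul,
    TensorProduct.tmul_sum]
  · simp [smul_mul_assoc, Algebra.TensorProduct.tmul_mul_tmul, charIdempotent_mul]
  · intro b _ hb
    simp [Finset.sum_mul, smul_mul_assoc, Algebra.TensorProduct.tmul_mul_tmul,
      charIdempotent_mul, hb]
  · simp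

theorem charForm_charIdempotent (σ : G →* kˣ) (χ : H →* kˣ)
    [Decidable (χ = σ.comp H.subtype)] :
    charForm σ (charIdempotent χ : MonoidAlgebra k G) =
      if χ = σ.comp H.subtype then 1 else 0 := by
  classical
  rw [charForm, AlgHom.comp_apply, charTwist_charIdempotent, Bialgebra.counitAlgHom_apply,
    counit_charIdempotent]
  exact if_congr (mul_inv_eq_one (a := χ) (b := σ.comp H.subtype)) rfl rfl

/-- The form attached to `σ` is `1` on the idempotent of the restriction of `σ` to `H` and `0` on
the others, so a single column survives. -/
theorem sliceRight_charForm_bicharElement (ω : (H →* kˣ) →* (H →* kˣ) →* kˣ) (σ : G →* kˣ) :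
    sliceRight (charForm σ).toLinearMap (bicharElement ω) =
      (charSum fun α => ((ω α (σ.comp H.subtype) : kˣ) : k) : MonoidAlgebra k G) := by
  classical
  simp only [bicharElement, map_sum, map_smul, sliceRight_tmul, AlgHom.toLinearMap_apply,
    charForm_charIdempotent, charSum]
  simp

theorem sliceLeft_charForm_bicharElement (ω : (H →* kˣ) →* (H →* kˣ) →* kˣ) (σ : G →* kˣ) :
    sliceLeft (charForm σ).toLinearMap (bicharElement ω) =
      (charSum fun β => ((ω (σ.comp H.subtype) β : kˣ) : k) : MonoidAlgebra k G) := by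
  classical
  simp only [bicharElement, map_sum, map_smul, sliceLeft_tmul, AlgHom.toLinearMap_apply,
    charForm_charIdempotent, charSum]
  rw [Finset.sum_comm]
  simp

end GroupAlgebra

/-! ### Passing between the twisted and the untwisted Hopf algebra -/

section TwistedGroupAlgebra

open MonoidAlgebra Coalgebra HopfAlgebra

attribute [local instance] Fintype.ofFinite

/-- The square of `S^J` is conjugation by `v⁻¹ S(v)` when `S² = id`, and this element is `1` here.
-/
theorem HopfTwist.antipode_antipode {k A : Type*} [Field k] [Ring A] [HopfAlgebra k A]
    (T : HopfTwist k A) (hS : ∀ x : A, antipode k (antipode k x) = x)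
    (hv : antipode k T.v = T.v) (x : T.Twisted) : antipode k (antipode k x) = x := by
  have hvInv : antipode k T.vInv = T.vInv := by
    have h := congrArg (antipode k) T.v_mul_vInv
    rw [antipode_mul_antidistrib, hv, antipode_one] at h
    exact left_inv_eq_right_inv h T.v_mul_vInv
  have key : ∀ y : A, T.vInv * (antipode k (T.vInv * (antipode k y * T.v)) * T.v) = y := fun y => by
    rw [antipode_mul_antidistrib, antipode_mul_antidistrib, hS, hv, hvInv, mul_assoc, mul_assoc,
      T.vInv_mul_v, mul_one, ← mul_assoc, T.vInv_mul_v, one_mul]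
  exact key x

/-- Both `e ⊗ 1` and `e ⊗ e` are central in `A ⊗ A`, so conjugating the identity by `J` only changes
`Δ^J` into `Δ`. Here the twist disappears from the problem. -/
theorem HopfTwist.comul_mul_tmul_one {k A : Type*} [Field k] [Ring A] [HopfAlgebra k A]
    (T : HopfTwist k A) {e : A} (hcen : ∀ a, a * e = e * a)
    (h : T.comulTwist e * (e ⊗ₜ[k] (1 : A)) = e ⊗ₜ[k] e) :
    comul (R := k) e * (e ⊗ₜ[k] (1 : A)) = e ⊗ₜ[k] e := by
  have hcom : ∀ (b : A) (X : A ⊗[k] A), (∀ a, a * b = b * a) →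
      X * (e ⊗ₜ[k] b) = (e ⊗ₜ[k] b) * X := fun b X hb => by
    induction X with
    | zero => simp
    | add X Y hX hY => rw [add_mul, mul_add, hX, hY]
    | tmul c d => simp [hcen, hb]
  rw [T.comulTwist_apply, mul_assoc, mul_assoc, hcom 1 _ (by simp), ← mul_assoc (comul e)] at h
  calc comul (R := k) e * (e ⊗ₜ[k] (1 : A))
      = T.J * (↑T.J⁻¹ * ((comul (R := k) e * (e ⊗ₜ[k] (1 : A))) * T.J)) * ↑T.J⁻¹ := by
        rw [← mul_assoc (T.J : A ⊗[k] A), T.J.mul_inv, one_mul, mul_assoc, T.J.mul_inv, mul_one]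
    _ = e ⊗ₜ[k] e := by rw [h, hcom e _ hcen, mul_assoc, T.J.mul_inv, mul_one]

theorem HopfTwist.exists_smul_one_of_bot_eq_top {k A : Type*} [Field k] [Ring A]
    [HopfAlgebra k A] (T : HopfTwist k A) (h : (⊥ : Subalgebra k T.Twisted) = ⊤) (x : A) :
    ∃ r : k, r • (1 : A) = x := by
  have hx : ∀ y : T.Twisted, ∃ r : k, r • (1 : T.Twisted) = y := fun y => by
    have hmem : y ∈ (⊥ : Subalgebra k T.Twisted) := h ▸ Algebra.mem_top
    obtain ⟨r, hr⟩ := Algebra.mem_bot.mp hmem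
    exact ⟨r, (Algebra.algebraMap_eq_smul_one r).symm.trans hr⟩
  exact hx x

/-- The integral of a normal Hopf subalgebra of a twisted Hopf algebra, as an element of the
original Hopf algebra. -/
theorem HopfTwist.exists_central_integral {k A : Type*} [Field k] [Ring A] [HopfAlgebra k A]
    [CharZero k] [FiniteDimensional k A] (T : HopfTwist k A)
    (hS : ∀ x : A, antipode k (antipode k x) = x) (hv : antipode k T.v = T.v)
    {K : Subalgebra k T.Twisted} (hK : IsHopfSubalgebra K) (hN : IsAdjointStable K) :
    ∃ e : A, e ∈ K ∧ counit (R := k) e = 1 ∧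
      (∀ y : A, y ∈ K → y * e = counit (R := k) y • e) ∧ (∀ a : A, a * e = e * a) ∧
      comul (R := k) e * (e ⊗ₜ[k] (1 : A)) = e ⊗ₜ[k] e := by
  have : FiniteDimensional k T.Twisted := inferInstanceAs (FiniteDimensional k A)
  obtain ⟨e, heK, he1, hel, hec, hcomul⟩ :=
    hK.exists_central_integral (T.antipode_antipode hS hv) hN
  exact ⟨e, heK, he1, hel, hec, T.comul_mul_tmul_one hec hcomul⟩

variable {k G : Type*} [Field k] [Group G]

theorem antipode_antipode_monoidAlgebra (x : MonoidAlgebra k G) :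
    antipode k (antipode k x) = x := by
  ext g
  rw [coeff_antipode, coeff_antipode, inv_inv]

variable {H : Subgroup G} [Finite H] [IsMulCommutative H] [IsAlgClosed k] [CharZero k]

/-- Since `H` has exponent dividing `2`, the antipode fixes each `e_α`; hence `v = ∑ ω(α, α) e_α`,
which is fixed too. -/
theorem antipode_v_bicharTwist (hH : ∀ h : H, h * h = 1)
    (ω : (H →* kˣ) →* (H →* kˣ) →* kˣ) :
    antipode k (bicharTwist (G := G) ω).v = (bicharTwist (G := G) ω).v := by
  classical
  rw [HopfTwist.v_eq]
  change antipode k (HopfTwist.sandwichLeft k 1 (bicharElement ω)) =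
    HopfTwist.sandwichLeft k 1 (bicharElement ω)
  simp only [bicharElement, map_sum, map_smul, HopfTwist.sandwichLeft_tmul, mul_one,
    antipode_charIdempotent hH, antipode_mul_antidistrib]
  refine Finset.sum_congr rfl fun α _ => Finset.sum_congr rfl fun β _ => ?_
  rw [charIdempotent_mul, charIdempotent_mul]
  by_cases h : α = β
  · simp [h]
  · simp [h, Ne.symm h]

theorem charSum_val_mul_charSum_val_inv (f : (H →* kˣ) → kˣ) :
    (charSum (fun α => ((f α : kˣ) : k)) * charSum (fun α => (((f α)⁻¹ : kˣ) : k)) :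
      MonoidAlgebra k G) = 1 := by
  conv_lhs => rw [charSum, Finset.sum_mul]
  rw [← sum_charIdempotent (k := k) (H := H)]
  refine Finset.sum_congr rfl fun α _ => ?_
  rw [smul_mul_assoc, charIdempotent_mul_charSum, smul_smul, ← Units.val_mul, mul_inv_cancel,
    Units.val_one, one_smul]

/-! ### Slices of the twisted coproduct -/

variable (ω : (H →* kˣ) →* (H →* kˣ) →* kˣ)
  {K : Subalgebra k (bicharTwist (G := G) ω).Twisted}

/-- Slices of the twisted coproduct of an element of a Hopf subalgebra. -/
theorem charSum_mul_coeffMul_mul_charSum_mem [Finite G] (hH : ∀ h : H, h * h = 1)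
    (hK : IsHopfSubalgebra K) {x : MonoidAlgebra k G} (hx : x ∈ K) (α γ : H →* kˣ) (g : G) :
    (charSum (fun β => ((ω⁻¹ α β : kˣ) : k)) *
      coeffMul x (charIdempotent α * (single g 1 * charIdempotent γ)) *
      charSum (fun β => ((ω γ β : kˣ) : k)) : MonoidAlgebra k G) ∈ K := by
  -- The form is `a ↦ (e_α a e_γ g⁻¹)_1`: the idempotents select one row of `J⁻¹` and one of `J`,
  -- and `g⁻¹` becomes `g` under the antipode in `sliceLeft_mul_comul_mul`.
  let f : MonoidAlgebra k G →ₗ[k] k := coeffForm k (1 : G) ∘ₗ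
    LinearMap.mulLeft k (charIdempotent α) ∘ₗ
      LinearMap.mulRight k (charIdempotent γ * single g⁻¹ 1)
  have hmem : sliceLeft (A := MonoidAlgebra k G) f
      (bicharElement ω⁻¹ * (comul (R := k) x * bicharElement ω)) ∈ K :=
    sliceLeft_mem (A := (bicharTwist (G := G) ω).Twisted) f (hK.comul_mem x hx)
  have hf : ∀ X : MonoidAlgebra k G ⊗[k] MonoidAlgebra k G, sliceLeft f X =
      sliceLeft (coeffForm k (1 : G)) ((charIdempotent α ⊗ₜ[k] 1) * X *
        ((charIdempotent γ * single g⁻¹ 1) ⊗ₜ[k] 1)) := fun X => by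
    induction X with
    | zero => simp
    | add X Y hX hY => simp only [map_add, mul_add, add_mul, hX, hY]
    | tmul a b =>
      rw [Algebra.TensorProduct.tmul_mul_tmul, Algebra.TensorProduct.tmul_mul_tmul,
        sliceLeft_tmul, sliceLeft_tmul, one_mul, mul_one, mul_assoc]
      rfl
  have hs : ∀ (a b : MonoidAlgebra k G) (X : MonoidAlgebra k G ⊗[k] MonoidAlgebra k G),
      sliceLeft (coeffForm k (1 : G)) ((1 ⊗ₜ[k] a) * X * (1 ⊗ₜ[k] b)) =
        a * sliceLeft (coeffForm k (1 : G)) X * b := fun a b X => by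
    induction X with
    | zero => simp
    | add X Y hX hY => simp only [map_add, mul_add, add_mul, hX, hY]
    | tmul c d =>
      rw [Algebra.TensorProduct.tmul_mul_tmul, Algebra.TensorProduct.tmul_mul_tmul,
        sliceLeft_tmul, sliceLeft_tmul, one_mul, mul_one, mul_smul_comm, smul_mul_assoc]
  have hsplitL : ∀ a b : MonoidAlgebra k G,
      (a ⊗ₜ[k] b : MonoidAlgebra k G ⊗[k] MonoidAlgebra k G) = (1 ⊗ₜ[k] b) * (a ⊗ₜ[k] 1) :=
    fun a b => by rw [Algebra.TensorProduct.tmul_mul_tmul, one_mul, mul_one]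
  have hsplitR : ∀ a b : MonoidAlgebra k G,
      (a ⊗ₜ[k] b : MonoidAlgebra k G ⊗[k] MonoidAlgebra k G) = (a ⊗ₜ[k] 1) * (1 ⊗ₜ[k] b) :=
    fun a b => by rw [Algebra.TensorProduct.tmul_mul_tmul, one_mul, mul_one]
  have hcomm : ∀ a b : MonoidAlgebra k G,
      (1 ⊗ₜ[k] b : MonoidAlgebra k G ⊗[k] MonoidAlgebra k G) * (a ⊗ₜ[k] 1) =
        (a ⊗ₜ[k] 1) * (1 ⊗ₜ[k] b) := fun a b => by rw [← hsplitL, hsplitR]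
  have hγ : (((charIdempotent γ : MonoidAlgebra k G) * single g⁻¹ 1) ⊗ₜ[k] 1 :
      MonoidAlgebra k G ⊗[k] MonoidAlgebra k G) =
      (charIdempotent γ ⊗ₜ[k] 1) * (single g⁻¹ 1 ⊗ₜ[k] 1) := by
    rw [Algebra.TensorProduct.tmul_mul_tmul, one_mul]
  have hanti : antipode k (charIdempotent γ * single g⁻¹ 1 * charIdempotent α) =
      (charIdempotent α * (single g 1 * charIdempotent γ) : MonoidAlgebra k G) := by
    rw [antipode_mul_antidistrib, antipode_mul_antidistrib, antipode_charIdempotent hH,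
      antipode_charIdempotent hH, antipode_single, inv_inv]
    simp [CommSemiring.antipode_eq_id]
  convert hmem using 1
  rw [hf, ← hanti, ← sliceLeft_mul_comul_mul, ← hs]
  congr 1
  calc _ = ((1 ⊗ₜ[k] charSum fun β => ((ω⁻¹ α β : kˣ) : k)) * (charIdempotent α ⊗ₜ[k] 1)) *
        comul (R := k) x * (((charIdempotent γ ⊗ₜ[k] 1) * (single g⁻¹ 1 ⊗ₜ[k] 1)) *
          (1 ⊗ₜ[k] charSum fun β => ((ω γ β : kˣ) : k))) := by
        rw [hγ]; simp only [mul_assoc]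
    _ = (charIdempotent α ⊗ₜ[k] charSum fun β => ((ω⁻¹ α β : kˣ) : k)) *
        comul (R := k) x * ((charIdempotent γ ⊗ₜ[k] charSum fun β => ((ω γ β : kˣ) : k)) *
          (single g⁻¹ 1 ⊗ₜ[k] 1)) := by
        rw [← hsplitL, mul_assoc (charIdempotent γ ⊗ₜ[k] 1), ← hcomm,
          ← mul_assoc (charIdempotent γ ⊗ₜ[k] 1), ← hsplitR]
    _ = _ := by
        rw [← charIdempotent_tmul_one_mul_bicharElement, ←
          bicharElement_mul_charIdempotent_tmul_one, hγ]
        simp only [mul_assoc]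

/-- On a Hopf subalgebra of the twisted group algebra where a linear character `σ` of the group
is trivial, the twist by `σ` is conjugation by an element of the subalgebra `kH`, in two ways. -/
theorem charSum_mul_eq_charTwist_mul_charSum (hK : IsHopfSubalgebra K) (σ : G →* kˣ)
    (hσ : ∀ x : MonoidAlgebra k G, x ∈ K → charForm σ x = counit (R := k) x)
    {x : MonoidAlgebra k G} (hx : x ∈ K) :
    charSum (fun α => ((ω α (σ.comp H.subtype) : kˣ) : k)) * x =
        charTwist σ x * charSum (fun α => ((ω α (σ.comp H.subtype) : kˣ) : k)) ∧
      charSum (fun α => ((ω (σ.comp H.subtype) α : kˣ) : k)) * x =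
        charTwist σ x * charSum (fun α => ((ω (σ.comp H.subtype) α : kˣ) : k)) := by
  let f : (bicharTwist (G := G) ω).Twisted →ₗ[k] k := (charForm σ).toLinearMap
  have hf : ∀ x ∈ K, f x = counit (R := k) (A := (bicharTwist (G := G) ω).Twisted) x := hσ
  -- The twisted coproduct of `x` lies in `K ⊗ K`, where `σ` may be replaced by the counit, so the
  -- slice is `x`. As `σ` is an algebra map, the same slice can also be computed factor by factor on
  -- `J⁻¹ Δ(x) J`.
  have hR : sliceRight (A := MonoidAlgebra k G) (charForm σ).toLinearMap
      (bicharElement ω⁻¹ * (comul (R := k) x * bicharElement ω)) = x :=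
    (sliceRight_congr (A := (bicharTwist (G := G) ω).Twisted) hf (hK.comul_mem x hx)).trans
      (sliceRight_counit_comul (k := k) (A := (bicharTwist (G := G) ω).Twisted) x)
  have hL : sliceLeft (A := MonoidAlgebra k G) (charForm σ).toLinearMap
      (bicharElement ω⁻¹ * (comul (R := k) x * bicharElement ω)) = x :=
    (sliceLeft_congr (A := (bicharTwist (G := G) ω).Twisted) hf (hK.comul_mem x hx)).trans
      (sliceLeft_counit_comul (k := k) (A := (bicharTwist (G := G) ω).Twisted) x)
  rw [sliceRight_algHom_mul, sliceRight_algHom_mul, sliceRight_charForm_comul,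
    sliceRight_charForm_bicharElement, sliceRight_charForm_bicharElement] at hR
  rw [sliceLeft_algHom_mul, sliceLeft_algHom_mul, sliceLeft_charForm_comul,
    sliceLeft_charForm_bicharElement, sliceLeft_charForm_bicharElement] at hL
  constructor
  · conv_lhs => rw [← hR]
    rw [← mul_assoc]
    have := charSum_val_mul_charSum_val_inv (G := G) fun α => ω α (σ.comp H.subtype)
    exact (congrArg (· * _) this).trans (one_mul _)
  · conv_lhs => rw [← hL]
    rw [← mul_assoc]
    have := charSum_val_mul_charSum_val_inv (G := G) fun α => ω (σ.comp H.subtype) α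
    exact (congrArg (· * _) this).trans (one_mul _)

theorem eq_top_of_forall_single_mem
    (h : ∀ g : G, (single g 1 : MonoidAlgebra k G) ∈ K) : K = ⊤ := by
  refine eq_top_iff.mpr fun x _ => ?_
  have hx : ∀ x : MonoidAlgebra k G, x ∈ K := fun x => by
    induction x using MonoidAlgebra.induction_linear with
    | zero => exact K.zero_mem
    | add x y hx hy => exact K.add_mem hx hy
    | single g r =>
      have : (single g r : MonoidAlgebra k G) = r • single g 1 := by simp
      rw [this]
      exact K.smul_mem (h g) r
  exact hx x

theorem sum_charIdempotent_mul_mul (x : MonoidAlgebra k G) :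
    ∑ α : H →* kˣ, ∑ γ : H →* kˣ, charIdempotent α * (x * charIdempotent γ) = x := by
  simp only [← Finset.mul_sum, ← Finset.sum_mul, sum_charIdempotent, mul_one, one_mul]

/-- For constant coefficients the coefficientwise product is a scalar, and the outer factors act on
`e_α` and `e_γ` by scalars. So each slice is a nonzero multiple of `e_α g e_γ`, and summing these
over `α` and `γ` gives `g`. -/
theorem single_mem_of_coeff_const [Finite G] (hH : ∀ h : H, h * h = 1)
    (hK : IsHopfSubalgebra K) {x : MonoidAlgebra k G} (hx : x ∈ K) {c : k} (hc : c ≠ 0)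
    (hxc : ∀ g, x.coeff g = c) (g : G) : (single g 1 : MonoidAlgebra k G) ∈ K := by
  have h1 : ∀ α γ : H →* kˣ,
      (charIdempotent α * (single g 1 * charIdempotent γ) : MonoidAlgebra k G) ∈ K := by
    intro α γ
    have h := charSum_mul_coeffMul_mul_charSum_mem ω hH hK hx α γ g
    have h2 : (charSum (fun β => ((ω⁻¹ α β : kˣ) : k)) *
      coeffMul x (charIdempotent α * (single g 1 * charIdempotent γ)) *
      charSum (fun β => ((ω γ β : kˣ) : k)) : MonoidAlgebra k G) =
      (((ω⁻¹ α α : kˣ) : k) * c * ((ω γ γ : kˣ) : k)) •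
        (charIdempotent α * (single g 1 * charIdempotent γ)) := by
      rw [coeffMul_of_const hxc, mul_smul_comm, smul_mul_assoc, ← mul_assoc,
        charSum_mul_charIdempotent, mul_assoc, mul_assoc, charIdempotent_mul_charSum]
      simp only [mul_smul_comm, smul_mul_assoc, smul_smul]
      congr 1
      ring
    rw [h2] at h
    have hne : ((ω⁻¹ α α : kˣ) : k) * c * ((ω γ γ : kˣ) : k) ≠ 0 :=
      mul_ne_zero (mul_ne_zero (Units.ne_zero _) hc) (Units.ne_zero _)
    have h3 := K.smul_mem h (((ω⁻¹ α α : kˣ) : k) * c * ((ω γ γ : kˣ) : k))⁻¹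
    have h4 : (((ω⁻¹ α α : kˣ) : k) * c * ((ω γ γ : kˣ) : k))⁻¹ •
        (((ω⁻¹ α α : kˣ) : k) * c * ((ω γ γ : kˣ) : k)) •
        (charIdempotent α * (single g 1 * charIdempotent γ)) =
        (charIdempotent α * (single g 1 * charIdempotent γ) : MonoidAlgebra k G) := by
      rw [smul_smul, inv_mul_cancel₀ hne, one_smul]
    rw [← h4]
    exact h3
  rw [← sum_charIdempotent_mul_mul (H := H) (single g 1)]
  exact K.sum_mem fun α _ => K.sum_mem fun γ _ => h1 α γ

/-- Two facts combine: `w` centralizes `K`, being the quotient of two elements that conjugate `K` in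
the same way; and the corners `e_α K e_γ` contain every `e_α g e_γ`. Comparing the eigenvalues of
`w` on the two sides of a corner gives `α(w) = γ(w)` whenever `e_α g e_γ ≠ 0`. -/
theorem commute_of_coeff_ker [Finite G] (hH : ∀ h : H, h * h = 1)
    (hK : IsHopfSubalgebra K) (σ : G →* kˣ) (hσ : ∀ g, σ g = 1 ∨ σ g = -1)
    (hσH : σ.comp H.subtype ≠ 1)
    (hσK : ∀ x : MonoidAlgebra k G, x ∈ K → charForm σ x = counit (R := k) x)
    {x : MonoidAlgebra k G} (hx : x ∈ K) {c : k} (hc : c ≠ 0)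
    (hxc : ∀ g ∈ σ.ker, x.coeff g = c) (hx0 : ∀ g ∉ σ.ker, x.coeff g = 0) (w : H)
    (hw : ∀ α, ω α (σ.comp H.subtype) = ω (σ.comp H.subtype) α * α w) (g : G) :
    (w : G) * g = g * w := by
  classical
  set χ := σ.comp H.subtype with hχ
  -- elements of `K` commute with `w`
  have hcw : ∀ x : MonoidAlgebra k G, x ∈ K → single (w : G) 1 * x = x * single (w : G) 1 := by
    intro x hx
    obtain ⟨h1, h2⟩ := charSum_mul_eq_charTwist_mul_charSum ω hK σ hσK hx
    rw [← hχ] at h1 h2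
    have h3 : (charSum (fun α => ((ω χ α : kˣ) : k)) * single (w : G) 1 : MonoidAlgebra k G) =
        charSum (fun α => ((ω α χ : kˣ) : k)) := by
      rw [← sum_smul_charIdempotent (k := k) w, Finset.mul_sum]
      conv_rhs => rw [charSum]
      refine Finset.sum_congr rfl fun α _ => ?_
      rw [mul_smul_comm, charSum_mul_charIdempotent, smul_smul, hw, Units.val_mul, mul_comm]
    have h4 : (charSum (fun α => (((ω χ α)⁻¹ : kˣ) : k)) * charSum (fun α => ((ω χ α : kˣ) : k)) :
        MonoidAlgebra k G) = 1 := by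
      simpa using charSum_val_mul_charSum_val_inv (G := G) fun α => (ω χ α)⁻¹
    rw [← h3] at h1
    calc single (w : G) 1 * x
        = charSum (fun α => (((ω χ α)⁻¹ : kˣ) : k)) *
          (charSum (fun α => ((ω χ α : kˣ) : k)) * single (w : G) 1 * x) := by
          rw [← mul_assoc, ← mul_assoc, h4, one_mul]
      _ = charSum (fun α => (((ω χ α)⁻¹ : kˣ) : k)) *
          (charSum (fun α => ((ω χ α : kˣ) : k)) * x * single (w : G) 1) := by
          rw [h1, h2, mul_assoc]
      _ = _ := by rw [mul_assoc, ← mul_assoc, h4, one_mul]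
  have hew : ∀ α : H →* kˣ, (charIdempotent α * single (w : G) 1 : MonoidAlgebra k G) =
      ((α w : kˣ) : k) • charIdempotent α := fun α => by
    rw [← sum_smul_charIdempotent (k := k) w]
    exact charIdempotent_mul_charSum (fun β => ((β w : kˣ) : k)) α
  have hwe : ∀ α : H →* kˣ, (single (w : G) 1 * charIdempotent α : MonoidAlgebra k G) =
      ((α w : kˣ) : k) • charIdempotent α := single_mul_charIdempotent w
  have hkey : ∀ α γ : H →* kˣ, ((α w : kˣ) : k) •
      (charIdempotent α * (single g 1 * charIdempotent γ) : MonoidAlgebra k G) =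
      ((γ w : kˣ) : k) • (charIdempotent α * (single g 1 * charIdempotent γ)) := by
    intro α γ
    set y : MonoidAlgebra k G := charIdempotent α * (single g 1 * charIdempotent γ) with hy
    have hz := hcw _ (charSum_mul_coeffMul_mul_charSum_mem ω hH hK hx α γ g)
    set z : MonoidAlgebra k G := charSum (fun β => ((ω⁻¹ α β : kˣ) : k)) * coeffMul x y *
      charSum (fun β => ((ω γ β : kˣ) : k)) with hzdef
    have hαα : (charIdempotent α * charIdempotent α : MonoidAlgebra k G) = charIdempotent α := by
      rw [charIdempotent_mul, if_pos rfl]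
    have hγγ : (charIdempotent γ * charIdempotent γ : MonoidAlgebra k G) = charIdempotent γ := by
      rw [charIdempotent_mul, if_pos rfl]
    -- The slice contains `y` plus its twist by `σ`. The twist starts with the idempotent of `α χ⁻¹
    -- ≠ α`, so cutting by `e_α` on the left removes it.
    have hαχ : (charIdempotent α * charIdempotent (α * χ⁻¹) : MonoidAlgebra k G) = 0 := by
      rw [charIdempotent_mul, if_neg]
      intro h
      apply hσH
      ext t
      have h1 := DFunLike.congr_fun h t
      rw [MonoidHom.mul_apply, MonoidHom.inv_apply, left_eq_mul, inv_eq_one] at h1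
      rw [h1, MonoidHom.one_apply]
    have hmid : charIdempotent α * coeffMul x y * charIdempotent γ = (c / 2) • y := by
      rw [coeffMul_of_ker σ hσ hxc hx0, mul_smul_comm, smul_mul_assoc, mul_add, add_mul, hy,
        map_mul, map_mul, charTwist_charIdempotent, ← mul_assoc, hαα, ← mul_assoc _ _ (_ * _),
        ← hχ, hαχ, zero_mul, zero_mul, add_zero, mul_assoc, mul_assoc, hγγ]
    have hcorner : charIdempotent α * (z * charIdempotent γ) =
        (((ω⁻¹ α α : kˣ) : k) * (c / 2) * ((ω γ γ : kˣ) : k)) • y := by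
      rw [hzdef, mul_assoc, charSum_mul_charIdempotent, ← mul_assoc, ← mul_assoc,
        charIdempotent_mul_charSum, smul_mul_assoc, mul_smul_comm, smul_mul_assoc, hmid]
      simp only [smul_smul]
      congr 1
      ring
    have hne : ((ω⁻¹ α α : kˣ) : k) * (c / 2) * ((ω γ γ : kˣ) : k) ≠ 0 :=
      mul_ne_zero (mul_ne_zero (Units.ne_zero _) (div_ne_zero hc two_ne_zero)) (Units.ne_zero _)
    have h5 := congrArg (fun t => charIdempotent α * (t * charIdempotent γ)) hz
    beta_reduce at h5
    rw [mul_assoc z, hwe, mul_assoc (single (w : G) 1), ← mul_assoc (charIdempotent α), hew,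
      smul_mul_assoc, mul_smul_comm, mul_smul_comm, hcorner, smul_comm,
      smul_comm ((γ w : kˣ) : k)] at h5
    exact smul_right_injective _ hne h5
  have hsum : (single (w : G) 1 * single g 1 : MonoidAlgebra k G) =
      single g 1 * single (w : G) 1 := by
    have h1 := sum_charIdempotent_mul_mul (H := H) (single g 1 : MonoidAlgebra k G)
    calc (single (w : G) 1 * single g 1 : MonoidAlgebra k G)
        = ∑ α : H →* kˣ, ∑ γ : H →* kˣ, ((α w : kˣ) : k) •
          (charIdempotent α * (single g 1 * charIdempotent γ)) := by
          conv_lhs => rw [← h1]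
          simp only [Finset.mul_sum]
          refine Finset.sum_congr rfl fun α _ => Finset.sum_congr rfl fun γ _ => ?_
          rw [← mul_assoc, hwe, smul_mul_assoc]
      _ = ∑ α : H →* kˣ, ∑ γ : H →* kˣ, ((γ w : kˣ) : k) •
          (charIdempotent α * (single g 1 * charIdempotent γ)) :=
          Finset.sum_congr rfl fun α _ => Finset.sum_congr rfl fun γ _ => hkey α γ
      _ = _ := by
          conv_rhs => rw [← h1]
          simp only [Finset.sum_mul]
          refine Finset.sum_congr rfl fun α _ => Finset.sum_congr rfl fun γ _ => ?_
          rw [mul_assoc, mul_assoc, hew, mul_smul_comm, mul_smul_comm]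
  rw [single_mul_single, single_mul_single] at hsum
  exact MonoidAlgebra.single_left_injective (mul_ne_zero one_ne_zero one_ne_zero) hsum

/-! ### The simplicity criterion -/

/-- A criterion for the simplicity of the twist of a group algebra by a bicharacter on the dual of
an elementary abelian `2`-subgroup, when all proper nontrivial normal subgroups are the kernel of
one quadratic character. -/
theorem isSimpleHopfAlgebra_bicharTwist [Finite G] (hH : ∀ h : H, h * h = 1)
    (σ : G →* kˣ) (hσ : ∀ g, σ g = 1 ∨ σ g = -1) (hσH : σ.comp H.subtype ≠ 1)
    (hnormal : ∀ N : Subgroup G, N.Normal → N = ⊥ ∨ N = σ.ker ∨ N = ⊤) (w : H)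
    (hw : ∀ α, ω α (σ.comp H.subtype) = ω (σ.comp H.subtype) α * α w)
    (hcen : ∃ g : G, (w : G) * g ≠ g * w) :
    IsSimpleHopfAlgebra k (bicharTwist (G := G) ω).Twisted where
  bot_ne_top := by
    intro h
    obtain ⟨g, hg⟩ := hcen
    have hg1 : g ≠ 1 := fun h1 => hg (by rw [h1, mul_one, one_mul])
    obtain ⟨r, hr⟩ := (bicharTwist ω).exists_smul_one_of_bot_eq_top h (single g 1)
    have h1 := congrArg (fun x => x.coeff g) hr
    simp [hg1, one_def, coeff_single] at h1
  eq_bot_or_eq_top := fun K hK hN => by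
    obtain ⟨e, heK, he1, hel, hec, hcomul⟩ := (bicharTwist ω).exists_central_integral
      antipode_antipode_monoidAlgebra (antipode_v_bicharTwist hH ω) hK hN
    obtain ⟨N, hNn, c, hc, hcN, hcN'⟩ := exists_normal_coeff_eq he1 hec hcomul
    rcases hnormal N hNn with rfl | rfl | rfl
    · left
      have he : e = single 1 c := by
        classical
        ext g
        rw [coeff_single, Finsupp.single_apply]
        split_ifs with hg
        · exact hg ▸ hcN 1 (one_mem _)
        · exact hcN' g fun h => hg (Subgroup.mem_bot.mp h).symm
      have hc1 : c = 1 := by simpa [he] using he1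
      have he' : e = 1 := by rw [hc1] at he; exact he
      refine eq_bot_iff.mpr fun x hx => ?_
      have hel' : ∀ y : MonoidAlgebra k G, y ∈ K → y = counit (R := k) y • 1 := fun y hy => by
        have := hel y hy
        rwa [he', mul_one] at this
      have hx1 : x = counit (R := k) x • (1 : (bicharTwist (G := G) ω).Twisted) := hel' x hx
      rw [hx1]
      exact Subalgebra.smul_mem _ (one_mem _) _
    · exfalso
      obtain ⟨g, hg⟩ := hcen
      refine hg (commute_of_coeff_ker ω hH hK σ hσ hσH (fun x hx => ?_) heK hc hcN hcN' w hw g)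
      have h1 := hel x hx
      have h2 : charTwist σ e = e := by
        ext g
        rw [coeff_charTwist]
        by_cases hg : g ∈ σ.ker
        · rw [MonoidHom.mem_ker.mp hg, Units.val_one, mul_one]
        · rw [hcN' g hg, zero_mul]
      -- The support of `e` is in the kernel of `σ`, so `σ(e) = ε(e) = 1`; applying `σ` to `x e =
      -- ε(x) e` shows that `σ` and `ε` agree on `K`.
      have h3 : charForm σ e = 1 := by
        rw [charForm, AlgHom.comp_apply, h2]
        exact he1
      have h4 := congrArg (charForm σ) h1
      rwa [map_mul, map_smul, h3, mul_one, smul_eq_mul, mul_one] at h4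
    · right
      exact eq_top_of_forall_single_mem ω fun g =>
        single_mem_of_coeff_const ω hH hK heK hc (fun g => hcN g trivial) g

end TwistedGroupAlgebra

/-! ### The sign character, the element `t_1 ⋯ t_n` and the normal subgroups of `S_{2n}` -/

section PairSubgroup

theorem exists_eq_pairFst_or_pairSnd {n : ℕ} (x : Fin (2 * n)) :
    ∃ i : Fin n, x = pairFst i ∨ x = pairSnd i := by
  refine ⟨⟨x / 2, by omega⟩, ?_⟩
  rcases Nat.mod_two_eq_zero_or_one x with h | h
  · left; exact Fin.ext (by simp only [pairFst]; omega)
  · right; exact Fin.ext (by simp only [pairSnd]; omega)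

theorem pairSubgroup_mul_self {n : ℕ} (h : pairSubgroup n) : h * h = 1 := by
  refine Subtype.ext (Equiv.ext fun x => ?_)
  change (h : Equiv.Perm (Fin (2 * n))) ((h : Equiv.Perm (Fin (2 * n))) x) = x
  obtain ⟨i, rfl | rfl⟩ := exists_eq_pairFst_or_pairSnd x <;>
    rcases pairSubgroup_apply i h with hi | hi <;> simp only [hi]

/-- The product `t_1 ⋯ t_n` in `H`. -/
def pairGenProd (n : ℕ) : pairSubgroup n := (List.ofFn pairGen).prod

variable (k : Type*) [Field k]

/-- The sign of a permutation, as a unit of the field `k`. -/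
def signChar (n : ℕ) : Equiv.Perm (Fin (2 * n)) →* kˣ :=
  (Units.map (Int.castRingHom k : ℤ →* k)).comp Equiv.Perm.sign

theorem signChar_eq_one_or {n : ℕ} (g : Equiv.Perm (Fin (2 * n))) :
    signChar k n g = 1 ∨ signChar k n g = -1 := by
  rw [signChar, MonoidHom.comp_apply]
  rcases Int.units_eq_one_or (Equiv.Perm.sign g) with h | h
  · left; rw [h, map_one]
  · right; rw [h]; ext; simp

theorem signChar_pairGen {n : ℕ} (i : Fin n) :
    (signChar k n).comp (pairSubgroup n).subtype (pairGen i) = -1 := by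
  have h : Equiv.Perm.sign (pairSwap i) = -1 :=
    Equiv.Perm.sign_swap (pairFst_ne_pairSnd i i)
  change Units.map _ (Equiv.Perm.sign (pairSwap i)) = -1
  rw [h]; ext; simp

theorem pairChar_pairGenProd {n : ℕ} (i : Fin n) : pairChar k i (pairGenProd n) = -1 := by
  rw [pairGenProd, map_list_prod, List.map_ofFn, List.prod_ofFn, Finset.prod_eq_single i]
  · simp [pairChar_pairGen]
  · intro b _ hb; simp [pairChar_pairGen, hb.symm]
  · simp

variable [CharZero k]

theorem neg_one_ne_one_units : (-1 : kˣ) ≠ 1 := fun h => by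
  have := congrArg Units.val h
  norm_num [eq_comm, CharZero.neg_eq_self_iff] at this

theorem pairGenProd_pairFst {n : ℕ} (i : Fin n) :
    (pairGenProd n : Equiv.Perm (Fin (2 * n))) (pairFst i) = pairSnd i := by
  rcases pairSubgroup_apply i (pairGenProd n) with h | h
  · have h1 := pairChar_pairGenProd ℚ i
    have h2 : pairChar ℚ i (pairGenProd n) = 1 := if_pos h.1
    exact absurd (h1.symm.trans h2) (neg_one_ne_one_units ℚ)
  · exact h.1

theorem signPairing_neg_one_left (x : kˣ) (hx : x = 1 ∨ x = -1) : signPairing k (-1) x = x := by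
  rcases hx with rfl | rfl <;> simp [signPairing]

theorem pairBicharacter_signChar_pairChar {n : ℕ} (j : Fin n) :
    pairBicharacter k n ((signChar k n).comp (pairSubgroup n).subtype) (pairChar k j) =
      ∏ i : Fin n, if i < j then -1 else 1 := by
  change (∏ a : Fin n, ∏ b : Fin n, if a < b then signPairing k
    ((signChar k n).comp (pairSubgroup n).subtype (pairGen a)) (pairChar k j (pairGen b))
    else 1) = _
  refine Finset.prod_congr rfl fun a _ => ?_
  rw [Finset.prod_eq_single j]
  · rw [signChar_pairGen, signPairing_neg_one_left _ _ (char_pairGen _ _), pairChar_pairGen,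
      if_pos rfl]
  · intro b _ hb
    rw [signChar_pairGen, signPairing_neg_one_left _ _ (char_pairGen _ _), pairChar_pairGen,
      if_neg hb.symm, ite_self]
  · simp

theorem pairBicharacter_pairChar_signChar {n : ℕ} (j : Fin n) :
    pairBicharacter k n (pairChar k j) ((signChar k n).comp (pairSubgroup n).subtype) =
      ∏ i : Fin n, if j < i then -1 else 1 := by
  change (∏ a : Fin n, ∏ b : Fin n, if a < b then signPairing k
    (pairChar k j (pairGen a)) ((signChar k n).comp (pairSubgroup n).subtype (pairGen b))
    else 1) = _
  rw [Finset.prod_comm]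
  refine Finset.prod_congr rfl fun b _ => ?_
  rw [Finset.prod_eq_single j]
  · rw [signChar_pairGen, signPairing_comm, signPairing_neg_one_left _ _ (char_pairGen _ _),
      pairChar_pairGen, if_pos rfl]
  · intro a _ ha
    rw [signChar_pairGen, signPairing_comm, signPairing_neg_one_left _ _ (char_pairGen _ _),
      pairChar_pairGen, if_neg ha.symm, ite_self]
  · simp

/-- Both sides are multiplicative in `α`, so `α = a_j` suffices. The two values of `ω` are `-1` to
the number of indices above `j` and below `j`; these numbers add up to `n - 1`, which is odd, and
`a_j(t_1 ⋯ t_n) = -1` makes up for it. This is where the parity of `n` enters. -/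
theorem pairBicharacter_apply_signChar {n : ℕ} (hn : Even n) (α : pairSubgroup n →* kˣ) :
    pairBicharacter k n α ((signChar k n).comp (pairSubgroup n).subtype) =
      pairBicharacter k n ((signChar k n).comp (pairSubgroup n).subtype) α *
        α (pairGenProd n) := by
  suffices h : (pairBicharacter k n).flip ((signChar k n).comp (pairSubgroup n).subtype) =
      pairBicharacter k n ((signChar k n).comp (pairSubgroup n).subtype) *
        MonoidHom.eval (pairGenProd n) from DFunLike.congr_fun h α
  refine MonoidHom.eq_of_eqOn_dense (closure_pairChar k n) ?_
  rintro _ ⟨j, rfl⟩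
  rw [MonoidHom.flip_apply, MonoidHom.mul_apply, MonoidHom.eval_apply_apply,
    pairBicharacter_signChar_pairChar, pairBicharacter_pairChar_signChar, pairChar_pairGenProd]
  have h1 : (∏ i : Fin n, if i < j then (-1 : kˣ) else 1) * -1 =
      ∏ i : Fin n, if i ≤ j then (-1 : kˣ) else 1 := by
    have h2 : (-1 : kˣ) = ∏ i : Fin n, if i = j then (-1 : kˣ) else 1 := by simp
    refine (congrArg (_ * ·) h2).trans ?_
    rw [← Finset.prod_mul_distrib]
    refine Finset.prod_congr rfl fun i _ => ?_
    rcases lt_trichotomy i j with h | h | h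
    · simp [h, h.le, h.ne]
    · simp [h]
    · simp [h.not_gt, h.not_ge, h.ne']
  rw [h1]
  -- The extra sign has become the factor `i = j`. Multiplying both sides by the product over `i ≤
  -- j` turns them into `(-1)^n` and `1`.
  refine mul_right_cancel (b := ∏ i : Fin n, if i ≤ j then (-1 : kˣ) else 1) ?_
  rw [← Finset.prod_mul_distrib, ← Finset.prod_mul_distrib]
  have h3 : ∀ i : Fin n, (if j < i then (-1 : kˣ) else 1) * (if i ≤ j then -1 else 1) = -1 :=
    fun i => by
      rcases lt_or_ge j i with h | h
      · simp [h, h.not_ge]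
      · simp [h, h.not_gt]
  have h4 : ∀ i : Fin n, (if i ≤ j then (-1 : kˣ) else 1) * (if i ≤ j then -1 else 1) = 1 :=
    fun i => by split_ifs <;> simp
  rw [Finset.prod_congr rfl fun i _ => h3 i, Finset.prod_congr rfl fun i _ => h4 i]
  simp [hn.neg_one_pow]

theorem mem_ker_signChar {n : ℕ} (g : Equiv.Perm (Fin (2 * n))) :
    g ∈ (signChar k n).ker ↔ g ∈ alternatingGroup (Fin (2 * n)) := by
  rw [MonoidHom.mem_ker, Equiv.Perm.mem_alternatingGroup, signChar, MonoidHom.comp_apply]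
  rcases Int.units_eq_one_or (Equiv.Perm.sign g) with h | h
  · simp [h]
  · rw [h]
    have h1 : Units.map (Int.castRingHom k : ℤ →* k) (-1) = -1 := by ext; simp
    rw [h1]
    exact iff_of_false (neg_one_ne_one_units k) (by decide)

/-- As `2n ≥ 6`, a nontrivial normal subgroup contains the alternating group. That group has index
two, so any odd element in addition generates everything. -/
theorem eq_bot_or_ker_signChar_or_top {n : ℕ} (hn : 3 ≤ n)
    (N : Subgroup (Equiv.Perm (Fin (2 * n)))) (hN : N.Normal) :
    N = ⊥ ∨ N = (signChar k n).ker ∨ N = ⊤ := by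
  rcases N.bot_or_nontrivial with h | h
  · exact Or.inl h
  right
  have hle : (signChar k n).ker ≤ N := fun g hg =>
    Equiv.Perm.alternatingGroup_le_of_normal (by rw [Nat.card_fin]; omega) h
      ((mem_ker_signChar k g).mp hg)
  by_cases hNk : N ≤ (signChar k n).ker
  · exact Or.inl (le_antisymm hNk hle)
  · right
    obtain ⟨g, hgN, hg⟩ := SetLike.not_le_iff_exists.mp hNk
    rw [MonoidHom.mem_ker] at hg
    refine eq_top_iff.mpr fun x _ => ?_
    by_cases hx : x ∈ (signChar k n).ker
    · exact hle hx
    · rw [MonoidHom.mem_ker] at hx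
      have hxg : x * g ∈ (signChar k n).ker := by
        rw [MonoidHom.mem_ker, map_mul, (signChar_eq_one_or k x).resolve_left hx,
          (signChar_eq_one_or k g).resolve_left hg]
        simp
      exact (Subgroup.mul_mem_cancel_right N hgN).mp (hle hxg)

end PairSubgroup

/-! ### The theorem for the symmetric group -/

theorem mainTheorem9 {k : Type*} [Field k] [IsAlgClosed k] [CharZero k] (n : ℕ) (hn : 3 ≤ n)
    (hn_even : Even n) :
    IsSimpleHopfAlgebra k (bicharTwist (pairBicharacter k n)).Twisted := by
  let i : Fin n := ⟨0, by omega⟩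
  let j : Fin n := ⟨1, by omega⟩
  refine isSimpleHopfAlgebra_bicharTwist (pairBicharacter k n) pairSubgroup_mul_self
    (signChar k n) (signChar_eq_one_or k) (fun h => ?_) (eq_bot_or_ker_signChar_or_top k hn)
    (pairGenProd n) (pairBicharacter_apply_signChar k hn_even)
    -- A transposition joining two pairs does not commute with `t_1 ⋯ t_n`: on the first point of
    -- pair `i` the two products give the second point of pair `i` and the first point of pair `j`.
    ⟨Equiv.swap (pairSnd i) (pairFst j), fun h => ?_⟩
  · have h1 := signChar_pairGen k i
    rw [h, MonoidHom.one_apply] at h1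
    exact neg_one_ne_one_units k h1.symm
  · have hij : i ≠ j := by simp [i, j]
    have h1 := congrArg (fun f : Equiv.Perm (Fin (2 * n)) => f (pairFst i)) h
    simp only [Equiv.Perm.mul_apply] at h1
    rw [Equiv.swap_apply_of_ne_of_ne (pairFst_ne_pairSnd i i) (pairFst_injective.ne hij),
      pairGenProd_pairFst, Equiv.swap_apply_left] at h1
    exact pairFst_ne_pairSnd j i h1.symm
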